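/- Let $h_t$, $0\le t\le 1$, be a smooth geodesic in the space of $S^1$-invariant smooth Hermitian metrics of positive curvature on $\mathcal O(1)\to\mathbf{CP}^1$: $h_t$ is smooth jointly in $t\in[0,1]$ and the point of $\mathbf{CP}^1$, each $\omega_t=\mathrm{Ric}(h_t)$ is positive, and, writing $h_t=e^{-u_t}$ in the affine chart $z$ with $\omega_t=\sqrt{-1}\,\partial\bar\partial u_t>0$, we have $\ddot u_t=|\partial\dot u_t|^2_{\omega_t}=|\partial_z\dot u_t|^2/\partial_z\partial_{\bar z}u_t$. Put $U_t(\rho)=u_t(z)$ for $\rho=\log|z|^2$, and let $$G_t(x)=\sup_{\rho\in\mathbf R}\,(x\rho-U_t(\rho))$$ be the symplectic potential. Let $h_P$ be the Fubini–Study metric, $u_P=\log(1+|z|^2)$, with symplectic potential $G_P(x)=x\log x+(1-x)\log(1-x)$, let $\omega_P=\mathrm{Ric}(h_P)$, and let $f_t=G_t-G_P$. For an integer $N\ge1$ and real $\alpha\in[0,1]$ let $$Q_t^N(\alpha)=e^{-NG_t(\alpha)}\int_{\mathbf C}|z|^{2N\alpha}e^{-Nu_t}\,\omega_t,\qquad Q_P^N(\alpha)=e^{-NG_P(\alpha)}\int_{\mathbf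 C}|z|^{2N\alpha}e^{-Nu_P}\,\omega_P,\qquad q_t^N(\alpha)=\frac{Q_t^N(\alpha)}{Q_P^N(\alpha)}.$$ Then for all $t\in[0,1]$ and $\alpha\in(0,\frac23]$ one has $G_t''(\alpha)>0$, $1+\alpha(1-\alpha)f_t''(\alpha)>0$ and $$\frac{G_P''(\alpha)}{G_t''(\alpha)}=\frac1{1+\alpha(1-\alpha)f_t''(\alpha)},$$ and there are functions $B_{t,k}(\alpha)$, $k\ge0$, of $(t,\alpha)\in[0,1]\times(0,\frac23]$, independent of $N$, with $B_{t,0}=1$ and each $B_{t,k}(\alpha)$ bounded uniformly in $(t,\alpha)$, such that the following holds. With $M=N\alpha$, for every integer $R\ge0$ there is $C_R>0$ such that for all integers $N\ge1$, all $t\in[0,1]$ and all $\alpha\in[N^{-3/4},\frac23]$ $$\left|q_t^N(\alpha)-\left(\frac{G_P''(\alpha)}{G_t''(\alpha)}\right)^{1/2}\sum_{k=0}^{R}\frac{B_{t,k}(\alpha)}{M^k}\right|\le C_R\,M^{-(R+1)}.$$ Moreover there is $C>0$ such that $\frac1C\le q_t^N(\alpha)\le C$ for all integers $N\ge1$, all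 $t\in[0,1]$ and all $\alpha\in[N^{-3/4},\frac23]$. -/

import Mathlib

open scoped ContDiff

noncomputable section

namespace ToricCP1

/-!
Hermitian metrics on the hyperplane bundle `O(1)` over the complex projective line.

A point of the projective line is a class `[Z₀ : Z₁]`, and a Hermitian metric `h` on `O(1)` is
encoded by the real function `φ` on `ℂ² \ {0}` with `|s|²_h (Z) = |s(Z)|² * exp (-φ Z)` for all
linear forms `s`. The metric is `C^∞` exactly when `φ` is, and the right hand side is well defined
on the projective line exactly when `φ (c Z) = φ Z + log |c|²`.
-/

/-- The coefficient `∂²u / ∂z ∂z̄` of a real function `u` on `ℂ`, that is, a quarter of its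
Laplacian. -/
def ddbar (u : ℂ → ℝ) (z : ℂ) : ℝ := Laplacian.laplacian u z / 4

/-- The Wirtinger derivative `∂u / ∂z = (∂u/∂x - i ∂u/∂y) / 2` of a real function `u` on `ℂ`. -/
def wirtinger (u : ℂ → ℝ) (z : ℂ) : ℂ :=
  ((fderiv ℝ u z 1 : ℂ) - Complex.I * (fderiv ℝ u z Complex.I : ℂ)) / 2

/-- The local potential in the affine chart `z = Z₁ / Z₀`, so that `|Z₀|²_h = exp (-u)`. -/
def chart (φ : ℂ × ℂ → ℝ) (z : ℂ) : ℝ := φ (1, z)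

/-- The local potential in the affine chart `w = Z₀ / Z₁`, so that `|Z₁|²_h = exp (-v)`. -/
def chartInfty (φ : ℂ × ℂ → ℝ) (w : ℂ) : ℝ := φ (w, 1)

/-- `φ` encodes a smooth Hermitian metric `h` on `O(1)` that is invariant under the circle action
`[Z₀ : Z₁] ↦ [Z₀ : e^{iθ} Z₁]` and has positive curvature form `Ric(h) = i ∂∂̄ φ`. -/
structure IsPositiveToricMetric (φ : ℂ × ℂ → ℝ) : Prop where
  smooth : ContDiffOn ℝ ∞ φ {0}ᶜ
  homogeneous : ∀ (c : ℂ) (Z : ℂ × ℂ), c ≠ 0 → Z ≠ 0 → φ (c • Z) = φ Z + Real.log (‖c‖ ^ 2)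
  invariant : ∀ (c : ℂ) (Z : ℂ × ℂ), ‖c‖ = 1 → Z ≠ 0 → φ (Z.1, c * Z.2) = φ Z
  positive : ∀ z : ℂ, 0 < ddbar (chart φ) z
  positive_infty : ∀ w : ℂ, 0 < ddbar (chartInfty φ) w

/-- `t ↦ φ t`, `0 ≤ t ≤ 1`, is a smooth geodesic in the space of positively curved toric metrics:
it is `C^∞` jointly in `t ∈ [0, 1]` and the point of the projective line, each `φ t` is a positive
toric metric, and `φ̈ = |∂φ̇|²_{ω_t}` where `ω_t = i u_{z z̄} dz ∧ dz̄`, hence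
`|∂ψ|²_{ω_t} = |ψ_z|² / u_{z z̄}`. -/
structure IsToricGeodesic (φ : ℝ → ℂ × ℂ → ℝ) : Prop where
  smooth : ContDiffOn ℝ ∞ (fun p : ℝ × (ℂ × ℂ) => φ p.1 p.2) (Set.Icc 0 1 ×ˢ {0}ᶜ)
  metric : ∀ t ∈ Set.Icc (0 : ℝ) 1, IsPositiveToricMetric (φ t)
  geodesic : ∀ t ∈ Set.Ioo (0 : ℝ) 1, ∀ z : ℂ,
    iteratedDeriv 2 (fun s => chart (φ s) z) t
      = ‖wirtinger (fun ζ => deriv (fun s => chart (φ s) ζ) t) z‖ ^ 2 / ddbar (chart (φ t)) z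

/-- The potential in the logarithmic coordinate `ρ = log |z|²`. -/
def logPotential (φ : ℂ × ℂ → ℝ) (ρ : ℝ) : ℝ := chart φ (Real.exp (ρ / 2) : ℂ)

/-- The symplectic potential `G`, the Legendre transform of the convex function `U`:
`G x = sup_ρ (x ρ - U ρ)`. For `0 < x < 1` the supremum is attained where `x = U' ρ`. -/
def symplecticPotential (φ : ℂ × ℂ → ℝ) (x : ℝ) : ℝ := ⨆ ρ : ℝ, (x * ρ - logPotential φ ρ)

/-- The squared norm `∫ |z^{Nα}|²_{h^N} ω` of the monomial `z^{Nα}`, for real `α`. The integral is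
taken over the affine chart, whose complement is a point, and
`ω = i u_{z z̄} dz ∧ dz̄ = 2 u_{z z̄} dx dy`. -/
def monomialNormSq (φ : ℂ × ℂ → ℝ) (N : ℕ) (α : ℝ) : ℝ :=
  ∫ z : ℂ, ‖z‖ ^ (2 * (N * α)) * Real.exp (-(N * chart φ z)) * (2 * ddbar (chart φ) z)

/-- The canonical symplectic potential of the moment interval `[0, 1]`. -/
def canonicalPotential (x : ℝ) : ℝ := x * Real.log x + (1 - x) * Real.log (1 - x)

/-- The canonical metric, whose symplectic potential is `canonicalPotential`: the Fubini–Study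
metric, with potential `log (1 + |z|²)`. -/
def canonicalMetric (Z : ℂ × ℂ) : ℝ := Real.log (‖Z.1‖ ^ 2 + ‖Z.2‖ ^ 2)

/-- The norming constant `Q^N(α) = ‖z^{Nα}‖² exp (-N G(α))` of a toric metric. -/
def normingConstant (φ : ℂ × ℂ → ℝ) (N : ℕ) (α : ℝ) : ℝ :=
  monomialNormSq φ N α * Real.exp (-(N * symplecticPotential φ α))

/-- The norming constant of the canonical metric. -/
def canonicalNormingConstant (N : ℕ) (α : ℝ) : ℝ :=
  monomialNormSq canonicalMetric N α * Real.exp (-(N * canonicalPotential α))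

/-- The ratio `q^N(α)` of the norming constants. -/
def normingRatio (φ : ℂ × ℂ → ℝ) (N : ℕ) (α : ℝ) : ℝ :=
  normingConstant φ N α / canonicalNormingConstant N α

/-- The function `f = G - G_P`, the difference to the canonical symplectic potential. -/
def potentialDifference (φ : ℂ × ℂ → ℝ) (x : ℝ) : ℝ :=
  symplecticPotential φ x - canonicalPotential x

end ToricCP1

end

open ToricCP1

/-! In the coordinate `ρ = log |z|²` the norming constant is the one-dimensional integral `2π ∫ exp
(N (αρ - U ρ - G α)) U''(ρ) dρ`. The exponent has its only critical point at the `ρ_α` with `U'(ρ_α)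
= α`. Putting `ρ = ρ_α + τ` turns the integral into `α ∫ exp (-M Ψ) Ψ'' dτ`, where `M = N α` and `Ψ
τ = (U (ρ_α + τ) - U ρ_α) / α - τ` (`logNorming_eq`).

The difficulty is uniformity as `α → 0`, when `ρ_α → -∞` and `U''` degenerates. There `U'`, `U''`
and `α` are all comparable with `exp ρ`, and the higher derivatives are `O(exp ρ)`. After division
by `α` the phases therefore have derivatives bounded on `[-1, 1]` and `Ψ'' ≥ c > 0`, uniformly in
`t` and `α ≤ 2/3` (`exists_unifPhase`). These comparisons hold because `U` is a smooth function of
`r = exp (ρ / 2)` with vanishing derivative at `r = 0`, because `∂∂̄u > 0`, and because `[0, 1]`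
times a closed disc is compact.

Laplace's method then applies uniformly with large parameter `M` (`UnifPhase.exists_expansion`):
write `Ψ x = x² χ x`, rescale by `x = σ / √M`, and Taylor expand in `1 / √M`; odd orders integrate
to zero. Outside `[-1, 1]` one has `Ψ ≥ c / 2`, and `Ψ''` has total mass `1 / α`, so the tail is at
most `exp (-M c / 2) / α`. The condition `α ≥ N^(-3/4)` says exactly that `1 / α ≤ M³`, so this tail
is smaller than every power of `1 / M`.

The leading coefficient is `√(2π Ψ''(0)) = √(2π / (α G''(α)))`. Dividing by the same expansion for
the Fubini–Study metric (`exists_quotient_expansion`) leaves `√(G_P'' / G_t'')` in front. Lower and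
upper bounds for numerator and denominator give the two-sided estimate. -/

namespace ToricCP1

open Real Set Filter Topology MeasureTheory

/-! ### Families with uniformly bounded derivatives -/

section UnifSmooth

variable {ι : Type*}

/-- A family of smooth functions on the line, each of whose derivatives is bounded on `[-1, 1]`
uniformly over the family. -/
def UnifSmooth (p : ι → ℝ → ℝ) : Prop :=
  (∀ i, ContDiff ℝ ∞ (p i)) ∧
    ∀ k : ℕ, ∃ C : ℝ, ∀ i, ∀ x, |x| ≤ 1 → |iteratedDeriv k (p i) x| ≤ C

theorem UnifSmooth.zero : UnifSmooth (fun (_ : ι) (_ : ℝ) => (0 : ℝ)) := by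
  refine ⟨fun _ => contDiff_const, fun k => ⟨0, fun i x _ => ?_⟩⟩
  simp

theorem UnifSmooth.deriv {p : ι → ℝ → ℝ} (hp : UnifSmooth p) :
    UnifSmooth (fun i => deriv (p i)) := by
  refine ⟨fun i => (contDiff_infty_iff_deriv.1 (hp.1 i)).2, fun k => ?_⟩
  obtain ⟨C, hC⟩ := hp.2 (k + 1)
  refine ⟨C, fun i x hx => ?_⟩
  have := hC i x hx
  rwa [iteratedDeriv_succ'] at this

theorem UnifSmooth.sub {p q : ι → ℝ → ℝ} (hp : UnifSmooth p) (hq : UnifSmooth q) :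
    UnifSmooth (fun i x => p i x - q i x) := by
  refine ⟨fun i => (hp.1 i).sub (hq.1 i), fun k => ?_⟩
  obtain ⟨C, hC⟩ := hp.2 k
  obtain ⟨D, hD⟩ := hq.2 k
  refine ⟨C + D, fun i x hx => ?_⟩
  have h : iteratedDeriv k (fun x => p i x - q i x) x
      = iteratedDeriv k (p i) x - iteratedDeriv k (q i) x :=
    iteratedDeriv_sub ((hp.1 i).of_le (by exact_mod_cast le_top)).contDiffAt
      ((hq.1 i).of_le (by exact_mod_cast le_top)).contDiffAt
  rw [h]
  exact (abs_sub _ _).trans (add_le_add (hC i x hx) (hD i x hx))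

theorem UnifSmooth.mul {p q : ι → ℝ → ℝ} (hp : UnifSmooth p) (hq : UnifSmooth q) :
    UnifSmooth (fun i x => p i x * q i x) := by
  refine ⟨fun i => (hp.1 i).mul (hq.1 i), fun k => ?_⟩
  choose C hC using hp.2
  choose D hD using hq.2
  refine ⟨∑ j ∈ Finset.range (k + 1), (k.choose j : ℝ) * C j * D (k - j), fun i x hx => ?_⟩
  have h := norm_iteratedFDeriv_mul_le (𝕜 := ℝ) (hp.1 i) (hq.1 i) x (n := k)
    (by exact_mod_cast le_top)
  simp only [norm_iteratedFDeriv_eq_norm_iteratedDeriv, Real.norm_eq_abs] at h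
  refine h.trans (Finset.sum_le_sum fun j _ => ?_)
  have h1 := hC j i x hx
  have h2 := hD (k - j) i x hx
  have := (abs_nonneg _).trans h1
  gcongr

theorem hasDerivAt_average {f p : ℝ → ℝ} (hf : Continuous f) (hp : ContDiff ℝ 1 p) (x : ℝ) :
    HasDerivAt (fun x => ∫ θ in (0 : ℝ)..1, f θ * p (θ * x))
      (∫ θ in (0 : ℝ)..1, (f θ * θ) * deriv p (θ * x)) x := by
  have hp' : Continuous (deriv p) := hp.continuous_deriv le_rfl
  have hpc := hp.continuous
  obtain ⟨C, hC⟩ := ((isCompact_Icc (a := (0 : ℝ)) (b := 1)).prod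
    (isCompact_closedBall x 1)).exists_bound_of_continuousOn
    (f := fun q : ℝ × ℝ => (f q.1 * q.1) * deriv p (q.1 * q.2)) (by fun_prop)
  refine (intervalIntegral.hasDerivAt_integral_of_dominated_loc_of_deriv_le
    (F := fun x θ => f θ * p (θ * x)) (F' := fun x θ => (f θ * θ) * deriv p (θ * x))
    (bound := fun _ => C) (Metric.closedBall_mem_nhds x one_pos) ?_ ?_ ?_ ?_ ?_ ?_).2
  · exact Eventually.of_forall fun y =>
      Continuous.aestronglyMeasurable (by fun_prop)
  · exact Continuous.intervalIntegrable (by fun_prop) _ _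
  · exact Continuous.aestronglyMeasurable (by fun_prop)
  · refine Eventually.of_forall fun θ hθ y hy => ?_
    rw [uIoc_of_le zero_le_one] at hθ
    exact hC (θ, y) ⟨⟨hθ.1.le, hθ.2⟩, hy⟩
  · exact intervalIntegrable_const
  · refine Eventually.of_forall fun θ hθ y hy => ?_
    have h1 : HasDerivAt p (deriv p (θ * y)) (θ * y) :=
      (hp.differentiable (by norm_num)).differentiableAt.hasDerivAt
    have h2 : HasDerivAt (fun y => θ * y) θ y := by
      simpa using (hasDerivAt_id y).const_mul θ
    exact ((h1.comp y h2).const_mul (f θ)).congr_deriv (by ring)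

theorem iteratedDeriv_average {f p : ℝ → ℝ} (hf : Continuous f) (hp : ContDiff ℝ ∞ p) (k : ℕ) :
    iteratedDeriv k (fun x => ∫ θ in (0 : ℝ)..1, f θ * p (θ * x))
      = fun x => ∫ θ in (0 : ℝ)..1, (f θ * θ ^ k) * iteratedDeriv k p (θ * x) := by
  induction k with
  | zero => simp
  | succ k ih =>
    rw [iteratedDeriv_succ, ih]
    ext x
    have hk : ContDiff ℝ 1 (iteratedDeriv k p) := by
      rw [iteratedDeriv_eq_iterate]; exact (hp.iterate_deriv k).of_le (by exact_mod_cast le_top)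
    rw [(hasDerivAt_average (f := fun θ => f θ * θ ^ k) (by fun_prop) hk x).deriv,
      iteratedDeriv_succ]
    simp only [pow_succ, mul_assoc]

theorem contDiff_average {f p : ℝ → ℝ} (hf : Continuous f) (hp : ContDiff ℝ ∞ p) :
    ContDiff ℝ ∞ (fun x => ∫ θ in (0 : ℝ)..1, f θ * p (θ * x)) := by
  refine contDiff_of_differentiable_iteratedDeriv fun k _ => ?_
  rw [iteratedDeriv_average hf hp k]
  intro x
  have hk : ContDiff ℝ 1 (iteratedDeriv k p) := by
    rw [iteratedDeriv_eq_iterate]; exact (hp.iterate_deriv k).of_le (by exact_mod_cast le_top)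
  exact (hasDerivAt_average (f := fun θ => f θ * θ ^ k) (by fun_prop) hk x).differentiableAt

/-- Differentiation under the integral produces only factors `θ ^ k`, and `θ x` stays in `[-1, 1]`.
This makes the quotient `Ψ x / x²` uniformly smooth. -/
theorem UnifSmooth.average {f : ℝ → ℝ} (hf : Continuous f) {p : ι → ℝ → ℝ} (hp : UnifSmooth p) :
    UnifSmooth (fun i x => ∫ θ in (0 : ℝ)..1, f θ * p i (θ * x)) := by
  refine ⟨fun i => contDiff_average hf (hp.1 i), fun k => ?_⟩
  obtain ⟨C, hC⟩ := hp.2 k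
  obtain ⟨D, hD⟩ := (isCompact_Icc (a := (0 : ℝ)) (b := 1)).exists_bound_of_continuousOn
    (f := fun θ => f θ * θ ^ k) (by fun_prop)
  refine ⟨D * C, fun i x hx => ?_⟩
  rw [iteratedDeriv_average hf (hp.1 i) k]
  have h := intervalIntegral.norm_integral_le_of_norm_le_const (a := (0 : ℝ)) (b := 1)
    (f := fun θ => (f θ * θ ^ k) * iteratedDeriv k (p i) (θ * x)) (C := D * C) ?_
  · simpa using h
  · intro θ hθ
    rw [uIoc_of_le zero_le_one] at hθ
    rw [norm_mul]
    have h1 := hD θ ⟨hθ.1.le, hθ.2⟩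
    have h2 : |iteratedDeriv k (p i) (θ * x)| ≤ C := by
      refine hC i _ ?_
      rw [abs_mul, abs_of_pos hθ.1]
      nlinarith [hθ.2, abs_nonneg x]
    exact mul_le_mul h1 h2 (abs_nonneg _) ((norm_nonneg _).trans h1)

end UnifSmooth

/-! ### Laplace expansion of rescaled integrals -/

/-- Taylor's formula at `0` with a bound for the remainder, for a sequence of functions each of
which is the derivative of the preceding one. -/
theorem abs_sub_taylor_le (K : ℕ) {g : ℕ → ℝ → ℝ}
    (hg : ∀ n x, HasDerivAt (g n) (g (n + 1) x) x) {B r : ℝ}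
    (hB : ∀ x, |x| ≤ r → |g K x| ≤ B) (x : ℝ) (hx : |x| ≤ r) :
    |g 0 x - ∑ n ∈ Finset.range K, g n 0 * x ^ n / (n.factorial : ℝ)| ≤ B * |x| ^ K := by
  induction K generalizing g x with
  | zero => simpa using hB x hx
  | succ K ih =>
    have hB0 : 0 ≤ B := (abs_nonneg _).trans (hB x hx)
    have ih' := fun y hy => ih (g := fun n => g (n + 1)) (fun n => hg (n + 1)) hB y hy
    set f : ℝ → ℝ := fun y =>
      g 0 y - ∑ n ∈ Finset.range (K + 1), g n 0 * y ^ n / (n.factorial : ℝ) with hf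
    have hder : ∀ y, HasDerivAt f
        (g 1 y - ∑ n ∈ Finset.range K, g (n + 1) 0 * y ^ n / (n.factorial : ℝ)) y := by
      intro y
      refine (hg 0 y).sub ?_
      have h1 : HasDerivAt (fun y => ∑ n ∈ Finset.range (K + 1),
          g n 0 * y ^ n / (n.factorial : ℝ))
          (∑ n ∈ Finset.range (K + 1), g n 0 * (n * y ^ (n - 1)) / (n.factorial : ℝ)) y := by
        refine HasDerivAt.fun_sum fun n _ => ?_
        exact ((hasDerivAt_pow n y).const_mul _).div_const _
      refine h1.congr_deriv ?_
      rw [Finset.sum_range_succ']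
      simp only [Nat.cast_zero, zero_mul, mul_zero, zero_div, add_zero]
      refine Finset.sum_congr rfl fun n _ => ?_
      rw [Nat.factorial_succ]
      have : (n.factorial : ℝ) ≠ 0 := by positivity
      have : (n + 1 : ℝ) ≠ 0 := by positivity
      push_cast
      field_simp
    have hmv := (convex_Icc (-|x|) |x|).norm_image_sub_le_of_norm_hasDerivWithin_le
      (f := f) (C := B * |x| ^ K)
      (fun y _ => (hder y).hasDerivWithinAt) (fun y hy => ?_)
      (show (0 : ℝ) ∈ Icc (-|x|) |x| by simp) (show x ∈ Icc (-|x|) |x| from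
        ⟨neg_abs_le x, le_abs_self x⟩)
    · have h0 : f 0 = 0 := by
        simp [hf, Finset.sum_range_succ']
      rw [h0, sub_zero, sub_zero] at hmv
      calc |f x| ≤ B * |x| ^ K * |x| := hmv
        _ = B * |x| ^ (K + 1) := by ring
    · have hy' : |y| ≤ |x| := abs_le.2 hy
      exact (ih' y (hy'.trans hx)).trans (by gcongr)

/-- The coefficients of the derivatives of `exp (-s χ) w`, see `hasDerivAt_phaseDeriv`. -/
noncomputable def phaseCoeff (χ w : ℝ → ℝ) : ℕ → ℕ → ℝ → ℝ
  | 0, 0 => w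
  | 0, _ + 1 => fun _ => 0
  | n + 1, 0 => deriv (phaseCoeff χ w n 0)
  | n + 1, j + 1 => fun x =>
      deriv (phaseCoeff χ w n (j + 1)) x - deriv χ x * phaseCoeff χ w n j x

theorem unifSmooth_phaseCoeff {ι : Type*} {χ w : ι → ℝ → ℝ} (hχ : UnifSmooth χ)
    (hw : UnifSmooth w) (n j : ℕ) : UnifSmooth (fun i => phaseCoeff (χ i) (w i) n j) := by
  induction n generalizing j with
  | zero =>
    cases j with
    | zero => exact hw
    | succ j => exact UnifSmooth.zero
  | succ n ih =>
    cases j with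
    | zero => exact (ih 0).deriv
    | succ j => exact (ih (j + 1)).deriv.sub (hχ.deriv.mul (ih j))

theorem phaseCoeff_eq_zero (χ w : ℝ → ℝ) (n j : ℕ) (h : n < j) :
    phaseCoeff χ w n j = fun _ => 0 := by
  induction n generalizing j with
  | zero =>
    cases j with
    | zero => omega
    | succ j => rfl
  | succ n ih =>
    cases j with
    | zero => omega
    | succ j =>
      ext x
      simp [phaseCoeff, ih (j + 1) (by omega), ih j (by omega)]

/-- The `n`-th derivative of `exp (-s χ) w`. -/
noncomputable def phaseDeriv (χ w : ℝ → ℝ) (n : ℕ) (s x : ℝ) : ℝ :=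
  exp (-(s * χ x)) * ∑ j ∈ Finset.range (n + 1), s ^ j * phaseCoeff χ w n j x

theorem hasDerivAt_phaseDeriv {χ w : ℝ → ℝ} (hχ : ContDiff ℝ ∞ χ)
    (hc : ∀ n j, ContDiff ℝ ∞ (phaseCoeff χ w n j)) (n : ℕ) (s x : ℝ) :
    HasDerivAt (phaseDeriv χ w n s) (phaseDeriv χ w (n + 1) s x) x := by
  have hd : ∀ {f : ℝ → ℝ}, ContDiff ℝ ∞ f → HasDerivAt f (deriv f x) x := fun hf =>
    (hf.differentiable (by simp)).differentiableAt.hasDerivAt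
  have h1 : HasDerivAt (fun x => exp (-(s * χ x)))
      (exp (-(s * χ x)) * -(s * deriv χ x)) x := ((hd hχ).const_mul s).neg.exp
  have h2 : HasDerivAt (fun x => ∑ j ∈ Finset.range (n + 1), s ^ j * phaseCoeff χ w n j x)
      (∑ j ∈ Finset.range (n + 1), s ^ j * deriv (phaseCoeff χ w n j) x) x :=
    HasDerivAt.fun_sum fun j _ => (hd (hc n j)).const_mul _
  refine (h1.mul h2).congr_deriv ?_
  have h3 : ∑ j ∈ Finset.range (n + 2), s ^ j * phaseCoeff χ w (n + 1) j x
      = ∑ j ∈ Finset.range (n + 2), s ^ j * deriv (phaseCoeff χ w n j) x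
        - s * deriv χ x * ∑ j ∈ Finset.range (n + 1), s ^ j * phaseCoeff χ w n j x := by
    rw [Finset.sum_range_succ', Finset.sum_range_succ' _ (n + 1), Finset.mul_sum,
      add_sub_right_comm, ← Finset.sum_sub_distrib]
    congr 1
    refine Finset.sum_congr rfl fun j _ => ?_
    simp only [phaseCoeff]
    ring
  -- The polynomial in `s` at stage `n` has degree at most `n`, so the extra term introduced to
  -- align the two sums vanishes.
  have h4 : deriv (phaseCoeff χ w n (n + 1)) x = 0 := by
    rw [phaseCoeff_eq_zero χ w n (n + 1) (by omega)]; simp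
  rw [Finset.sum_range_succ (fun j => s ^ j * deriv (phaseCoeff χ w n j) x) (n + 1), h4] at h3
  simp only [phaseDeriv]
  rw [show n + 1 + 1 = n + 2 from rfl, h3]
  ring

theorem integrable_one_add_sq_pow_mul_exp {b : ℝ} (hb : 0 < b) (m : ℕ) :
    Integrable (fun x : ℝ => (1 + x ^ 2) ^ m * exp (-(b * x ^ 2))) := by
  have h : (fun x : ℝ => (1 + x ^ 2) ^ m * exp (-(b * x ^ 2)))
      = fun x : ℝ => ∑ k ∈ Finset.range (m + 1),
        (m.choose k : ℝ) * (x ^ ((2 * (m - k) : ℕ) : ℝ) * exp (-b * x ^ 2)) := by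
    ext x
    rw [add_pow, Finset.sum_mul]
    refine Finset.sum_congr rfl fun k _ => ?_
    rw [rpow_natCast, one_pow, ← pow_mul, neg_mul]
    ring
  rw [h]
  exact integrable_finsetSum _ fun k _ =>
    (integrable_rpow_mul_exp_neg_mul_sq hb (by
      have : (0 : ℝ) ≤ ((2 * (m - k) : ℕ) : ℝ) := Nat.cast_nonneg _
      linarith)).const_mul _

theorem continuous_phaseDeriv_sq (χ w : ℝ → ℝ) (n : ℕ) (x : ℝ) :
    Continuous (fun σ : ℝ => phaseDeriv χ w n (σ ^ 2) x) := by
  unfold phaseDeriv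
  fun_prop

/-- The coefficients of the Laplace expansion. -/
noncomputable def laplaceCoeff (χ w : ℝ → ℝ) (n : ℕ) : ℝ :=
  ∫ σ : ℝ, phaseDeriv χ w n (σ ^ 2) 0 * σ ^ n / (n.factorial : ℝ)

/-- Apart from `σ ^ n` the integrand depends on `σ` only through `σ ^ 2`. Hence only integral powers
of `1 / M` survive. -/
theorem laplaceCoeff_odd (χ w : ℝ → ℝ) {n : ℕ} (hn : Odd n) : laplaceCoeff χ w n = 0 := by
  have h := integral_neg_eq_self
    (fun σ : ℝ => phaseDeriv χ w n (σ ^ 2) 0 * σ ^ n / (n.factorial : ℝ)) volume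
  simp only [neg_sq, hn.neg_pow, mul_neg, neg_div, integral_neg] at h
  unfold laplaceCoeff
  linarith

theorem laplaceCoeff_zero (χ w : ℝ → ℝ) : laplaceCoeff χ w 0 = √(π / χ 0) * w 0 := by
  unfold laplaceCoeff phaseDeriv
  simp only [zero_add, Finset.range_one, Finset.sum_singleton, pow_zero, one_mul, mul_one,
    Nat.factorial_zero, Nat.cast_one, div_one, phaseCoeff]
  rw [integral_mul_const, ← integral_gaussian]
  congr 2
  ext σ
  congr 1
  ring

section

variable {ι : Type*} {χ w : ι → ℝ → ℝ} {b : ℝ}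

/-- Each derivative in `x` brings down at most one factor `σ²`, while `χ ≥ b` preserves Gaussian
decay. The resulting majorant is integrable and independent of the index. -/
theorem exists_abs_phaseDeriv_le (hχ : UnifSmooth χ) (hw : UnifSmooth w)
    (hb : ∀ i x, |x| ≤ 1 → b ≤ χ i x) (n : ℕ) :
    ∃ C : ℝ, 0 ≤ C ∧ ∀ i σ x, |x| ≤ 1 →
      |phaseDeriv (χ i) (w i) n (σ ^ 2) x| ≤ C * ((1 + σ ^ 2) ^ n * exp (-(b * σ ^ 2))) := by
  choose C hC using fun j => (unifSmooth_phaseCoeff hχ hw n j).2 0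
  simp only [iteratedDeriv_zero] at hC
  refine ⟨∑ j ∈ Finset.range (n + 1), |C j|, by positivity, fun i σ x hx => ?_⟩
  unfold phaseDeriv
  rw [abs_mul, abs_of_pos (exp_pos _)]
  have h1 : exp (-(σ ^ 2 * χ i x)) ≤ exp (-(b * σ ^ 2)) := by
    rw [exp_le_exp, neg_le_neg_iff, mul_comm]
    exact mul_le_mul_of_nonneg_left (hb i x hx) (sq_nonneg σ)
  have h2 : |∑ j ∈ Finset.range (n + 1), (σ ^ 2) ^ j * phaseCoeff (χ i) (w i) n j x|
      ≤ (∑ j ∈ Finset.range (n + 1), |C j|) * (1 + σ ^ 2) ^ n := by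
    rw [Finset.sum_mul]
    refine (Finset.abs_sum_le_sum_abs _ _).trans (Finset.sum_le_sum fun j hj => ?_)
    rw [abs_mul, abs_of_nonneg (by positivity : 0 ≤ (σ ^ 2) ^ j), mul_comm]
    have h3 : (σ ^ 2) ^ j ≤ (1 + σ ^ 2) ^ n :=
      (pow_le_pow_left₀ (sq_nonneg σ) (by linarith) j).trans
        (pow_le_pow_right₀ (by nlinarith [sq_nonneg σ]) (by simpa [Nat.lt_succ_iff] using hj))
    exact mul_le_mul ((hC j i x hx).trans (le_abs_self _)) h3 (by positivity) (abs_nonneg _)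
  calc _ ≤ exp (-(b * σ ^ 2)) * ((∑ j ∈ Finset.range (n + 1), |C j|) * (1 + σ ^ 2) ^ n) :=
        mul_le_mul h1 h2 (abs_nonneg _) (exp_pos _).le
    _ = _ := by ring

theorem integrable_laplaceCoeff_integrand (hχ : UnifSmooth χ) (hw : UnifSmooth w) (hb0 : 0 < b)
    (hb : ∀ i x, |x| ≤ 1 → b ≤ χ i x) (n : ℕ) (i : ι) :
    Integrable (fun σ : ℝ => phaseDeriv (χ i) (w i) n (σ ^ 2) 0 * σ ^ n / (n.factorial : ℝ)) := by
  obtain ⟨C, hC0, hC⟩ := exists_abs_phaseDeriv_le hχ hw hb n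
  refine (((integrable_one_add_sq_pow_mul_exp hb0 (n + n)).const_mul C)).mono'
    (((continuous_phaseDeriv_sq _ _ n 0).mul (continuous_pow n)).div_const _).aestronglyMeasurable
    (Eventually.of_forall fun σ => ?_)
  have h1 := hC i σ 0 (by simp)
  have h2 : |σ| ≤ 1 + σ ^ 2 := by nlinarith [sq_nonneg (|σ| - 1), sq_abs σ, abs_nonneg σ]
  rw [norm_div, norm_mul, norm_pow, Real.norm_eq_abs, Real.norm_eq_abs]
  have h3 : ‖(n.factorial : ℝ)‖ = n.factorial := by simp
  have h4 : (1 : ℝ) ≤ n.factorial := by exact_mod_cast n.factorial_pos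
  rw [h3]
  calc _ ≤ |phaseDeriv (χ i) (w i) n (σ ^ 2) 0| * |σ| ^ n :=
        div_le_self (by positivity) h4
    _ ≤ (C * ((1 + σ ^ 2) ^ n * exp (-(b * σ ^ 2)))) * (1 + σ ^ 2) ^ n := by gcongr
    _ = _ := by ring

theorem exists_abs_laplaceCoeff_le (hχ : UnifSmooth χ) (hw : UnifSmooth w) (hb0 : 0 < b)
    (hb : ∀ i x, |x| ≤ 1 → b ≤ χ i x) (n : ℕ) :
    ∃ D : ℝ, ∀ i, |laplaceCoeff (χ i) (w i) n| ≤ D := by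
  obtain ⟨C, hC0, hC⟩ := exists_abs_phaseDeriv_le hχ hw hb n
  refine ⟨∫ σ : ℝ, C * ((1 + σ ^ 2) ^ (n + n) * exp (-(b * σ ^ 2))), fun i => ?_⟩
  rw [← Real.norm_eq_abs, laplaceCoeff]
  refine norm_integral_le_of_norm_le ((integrable_one_add_sq_pow_mul_exp hb0 (n + n)).const_mul C)
    (Eventually.of_forall fun σ => ?_)
  have h1 := hC i σ 0 (by simp)
  have h2 : |σ| ≤ 1 + σ ^ 2 := by nlinarith [sq_nonneg (|σ| - 1), sq_abs σ, abs_nonneg σ]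
  rw [norm_div, norm_mul, norm_pow, Real.norm_eq_abs, Real.norm_eq_abs]
  have h3 : ‖(n.factorial : ℝ)‖ = n.factorial := by simp
  have h4 : (1 : ℝ) ≤ n.factorial := by exact_mod_cast n.factorial_pos
  rw [h3]
  calc _ ≤ |phaseDeriv (χ i) (w i) n (σ ^ 2) 0| * |σ| ^ n :=
        div_le_self (by positivity) h4
    _ ≤ (C * ((1 + σ ^ 2) ^ n * exp (-(b * σ ^ 2)))) * (1 + σ ^ 2) ^ n := by gcongr
    _ = _ := by ring

/-- The expansion in powers of `ε` of the rescaled Laplace integral. -/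
theorem exists_laplace_rescaled (hχ : UnifSmooth χ) (hw : UnifSmooth w) (hb0 : 0 < b)
    (hb : ∀ i x, |x| ≤ 1 → b ≤ χ i x) (K : ℕ) :
    ∃ C : ℝ, ∀ i, ∀ ε : ℝ, 0 < ε →
      |(∫ σ in (-(1 / ε))..(1 / ε), exp (-(σ ^ 2 * χ i (ε * σ))) * w i (ε * σ))
        - ∑ n ∈ Finset.range K, ε ^ n * laplaceCoeff (χ i) (w i) n| ≤ C * ε ^ K := by
  choose C hC0 hC using exists_abs_phaseDeriv_le hχ hw hb
  -- `C K` serves the Taylor remainder where `|σ| ≤ 1 / ε`; the sum serves the Taylor polynomial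
  -- outside that window.
  set E : ℝ := C K + ∑ n ∈ Finset.range K, C n with hE
  have hint := (integrable_one_add_sq_pow_mul_exp hb0 (K + K)).const_mul E
  refine ⟨∫ σ : ℝ, E * ((1 + σ ^ 2) ^ (K + K) * exp (-(b * σ ^ 2))), fun i ε hε => ?_⟩
  set F : ℝ → ℝ := fun σ => exp (-(σ ^ 2 * χ i (ε * σ))) * w i (ε * σ) with hF
  have hFc : Continuous F := by
    have := (hχ.1 i).continuous
    have := (hw.1 i).continuous
    fun_prop
  set T : ℝ → ℝ := fun σ => ∑ n ∈ Finset.range K,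
    ε ^ n * (phaseDeriv (χ i) (w i) n (σ ^ 2) 0 * σ ^ n / (n.factorial : ℝ)) with hT
  have hTi : Integrable T := integrable_finsetSum _ fun n _ =>
    (integrable_laplaceCoeff_integrand hχ hw hb0 hb n i).const_mul _
  have hTs : ∑ n ∈ Finset.range K, ε ^ n * laplaceCoeff (χ i) (w i) n = ∫ σ, T σ := by
    rw [hT, integral_finsetSum _ fun n _ =>
      (integrable_laplaceCoeff_integrand hχ hw hb0 hb n i).const_mul _]
    simp only [integral_const_mul]
    rfl
  have hε' : -(1 / ε) ≤ 1 / ε := by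
    have : 0 < 1 / ε := by positivity
    linarith
  have hFi : Integrable ((Ioc (-(1 / ε)) (1 / ε)).indicator F) :=
    (integrable_indicator_iff measurableSet_Ioc).2
      (hFc.integrableOn_Icc.mono_set Ioc_subset_Icc_self)
  rw [intervalIntegral.integral_of_le hε', ← integral_indicator measurableSet_Ioc, hTs,
    ← integral_sub hFi hTi, mul_comm _ (ε ^ K), ← integral_const_mul, ← Real.norm_eq_abs]
  refine norm_integral_le_of_norm_le (hint.const_mul _) (Eventually.of_forall fun σ => ?_)
  rw [Real.norm_eq_abs]
  have h2 : |σ| ≤ 1 + σ ^ 2 := by nlinarith [sq_nonneg (|σ| - 1), sq_abs σ, abs_nonneg σ]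
  have h1s : 1 ≤ 1 + σ ^ 2 := by nlinarith [sq_nonneg σ]
  have hCs : 0 ≤ ∑ n ∈ Finset.range K, C n := Finset.sum_nonneg fun n _ => hC0 n
  by_cases hσ : σ ∈ Ioc (-(1 / ε)) (1 / ε)
  · rw [indicator_of_mem hσ]
    have hεσ : |ε * σ| ≤ 1 := by
      rw [abs_mul, abs_of_pos hε]
      have h3 : |σ| ≤ 1 / ε := abs_le.2 ⟨hσ.1.le, hσ.2⟩
      calc ε * |σ| ≤ ε * (1 / ε) := by gcongr
        _ = 1 := by field_simp
    have hE0 : 0 ≤ E := by linarith [hC0 K]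
    have h := abs_sub_taylor_le K (g := fun n => phaseDeriv (χ i) (w i) n (σ ^ 2))
      (fun n x => hasDerivAt_phaseDeriv (hχ.1 i)
        (fun n j => (unifSmooth_phaseCoeff hχ hw n j).1 i) n (σ ^ 2) x)
      (fun x hx => hC K i σ x hx) (ε * σ) hεσ
    have h0 : F σ - T σ = phaseDeriv (χ i) (w i) 0 (σ ^ 2) (ε * σ)
        - ∑ n ∈ Finset.range K,
          phaseDeriv (χ i) (w i) n (σ ^ 2) 0 * (ε * σ) ^ n / (n.factorial : ℝ) := by
      congr 1
      · simp [hF, phaseDeriv, phaseCoeff]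
      · refine Finset.sum_congr rfl fun n _ => ?_
        rw [mul_pow]; ring
    rw [h0]
    refine h.trans ?_
    rw [abs_mul, abs_of_pos hε, mul_pow]
    calc C K * ((1 + σ ^ 2) ^ K * exp (-(b * σ ^ 2))) * (ε ^ K * |σ| ^ K)
        ≤ E * ((1 + σ ^ 2) ^ K * exp (-(b * σ ^ 2))) * (ε ^ K * (1 + σ ^ 2) ^ K) := by
          gcongr
          linarith
      _ = _ := by ring
  · rw [indicator_of_notMem hσ, zero_sub, abs_neg]
    -- Outside the window `(ε |σ|) ^ n ≤ (ε |σ|) ^ K` for `n ≤ K`, so every Taylor term is itself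
    -- `O(ε ^ K)` and may be integrated over the whole line.
    have h3 : 1 ≤ ε * |σ| := by
      have : 1 / ε ≤ |σ| := by
        by_contra hlt
        push Not at hlt
        obtain ⟨ha, hb⟩ := abs_lt.1 hlt
        exact hσ ⟨ha, hb.le⟩
      calc 1 = ε * (1 / ε) := by field_simp
        _ ≤ _ := by gcongr
    have h4 : |T σ| ≤ ∑ n ∈ Finset.range K,
        C n * (ε ^ K * ((1 + σ ^ 2) ^ (K + K) * exp (-(b * σ ^ 2)))) := by
      refine (Finset.abs_sum_le_sum_abs _ _).trans (Finset.sum_le_sum fun n hn => ?_)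
      have hnK : n ≤ K := (Finset.mem_range.1 hn).le
      rw [abs_mul, abs_div, abs_mul, abs_pow, abs_pow, abs_of_pos hε,
        abs_of_nonneg (Nat.cast_nonneg n.factorial : (0 : ℝ) ≤ n.factorial)]
      have h5 : (1 : ℝ) ≤ n.factorial := by exact_mod_cast n.factorial_pos
      calc ε ^ n * (|phaseDeriv (χ i) (w i) n (σ ^ 2) 0| * |σ| ^ n / (n.factorial : ℝ))
          ≤ ε ^ n * (|phaseDeriv (χ i) (w i) n (σ ^ 2) 0| * |σ| ^ n) := by
            gcongr
            exact div_le_self (by positivity) h5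
        _ = (ε * |σ|) ^ n * |phaseDeriv (χ i) (w i) n (σ ^ 2) 0| := by ring
        _ ≤ (ε * |σ|) ^ K * (C n * ((1 + σ ^ 2) ^ n * exp (-(b * σ ^ 2)))) := by
            gcongr
            exact hC n i σ 0 (by simp)
        _ ≤ (ε * (1 + σ ^ 2)) ^ K * (C n * ((1 + σ ^ 2) ^ K * exp (-(b * σ ^ 2)))) := by
            have := hC0 n
            gcongr
        _ = _ := by rw [mul_pow]; ring
    rw [← Finset.sum_mul] at h4
    refine h4.trans ?_
    calc (∑ n ∈ Finset.range K, C n) * (ε ^ K * ((1 + σ ^ 2) ^ (K + K) * exp (-(b * σ ^ 2))))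
        ≤ E * (ε ^ K * ((1 + σ ^ 2) ^ (K + K) * exp (-(b * σ ^ 2)))) := by
          gcongr
          linarith [hC0 K]
      _ = _ := by ring

end

/-! ### Laplace's method for nondegenerate phases -/

/-- A family of phase functions with nondegenerate minimum `0` at the origin, uniformly controlled
on `[-1, 1]`. -/
structure UnifPhase {ι : Type*} (Ψ : ι → ℝ → ℝ) (c : ℝ) : Prop where
  unifSmooth : UnifSmooth Ψ
  zero : ∀ i, Ψ i 0 = 0
  deriv_zero : ∀ i, deriv (Ψ i) 0 = 0
  pos : 0 < c
  le_deriv2 : ∀ i x, |x| ≤ 1 → c ≤ deriv (deriv (Ψ i)) x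

/-- The function `χ` with `Ψ x = x² χ x`. -/
noncomputable def phaseQuotient (Ψ : ℝ → ℝ) (x : ℝ) : ℝ :=
  ∫ θ in (0 : ℝ)..1, (1 - θ) * deriv (deriv Ψ) (θ * x)

/-- Taylor's formula with integral remainder. Dividing by `x²` through an integral keeps the
quotient smooth at the origin. -/
theorem sq_mul_phaseQuotient {Ψ : ℝ → ℝ} (h : ContDiff ℝ ∞ Ψ) (h0 : Ψ 0 = 0)
    (h1 : deriv Ψ 0 = 0) (x : ℝ) : x ^ 2 * phaseQuotient Ψ x = Ψ x := by
  have hd := (contDiff_infty_iff_deriv.1 h)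
  have hdd := (contDiff_infty_iff_deriv.1 hd.2)
  have hc := hdd.2.continuous
  have key : ∀ θ ∈ uIcc (0 : ℝ) 1, HasDerivAt
      (fun θ => (1 - θ) * (x * deriv Ψ (θ * x)) + Ψ (θ * x))
      (x ^ 2 * ((1 - θ) * deriv (deriv Ψ) (θ * x))) θ := by
    intro θ _
    have hm : HasDerivAt (fun θ : ℝ => θ * x) x θ := by
      simpa using (hasDerivAt_id θ).mul_const x
    have e1 := (hd.1 (θ * x)).hasDerivAt.comp θ hm
    have e2 := (hdd.1 (θ * x)).hasDerivAt.comp θ hm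
    have e3 : HasDerivAt (fun θ : ℝ => 1 - θ) (-1) θ := by
      simpa using (hasDerivAt_id θ).const_sub 1
    refine ((e3.mul (e2.const_mul x)).add e1).congr_deriv ?_
    simp only [Function.comp_apply]
    ring
  have := intervalIntegral.integral_eq_sub_of_hasDerivAt key
    (Continuous.intervalIntegrable (by fun_prop) _ _)
  rw [intervalIntegral.integral_const_mul] at this
  unfold phaseQuotient
  rw [this]
  simp [h0, h1]

theorem UnifPhase.unifSmooth_quotient {ι : Type*} {Ψ : ι → ℝ → ℝ} {c : ℝ} (h : UnifPhase Ψ c) :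
    UnifSmooth (fun i => phaseQuotient (Ψ i)) :=
  UnifSmooth.average (f := fun θ => 1 - θ) (by fun_prop) h.unifSmooth.deriv.deriv

theorem integral_one_sub : ∫ θ in (0 : ℝ)..1, (1 - θ) = 1 / 2 := by
  rw [intervalIntegral.integral_sub (by simp) (by simp)]
  simp
  norm_num

theorem UnifPhase.le_quotient {ι : Type*} {Ψ : ι → ℝ → ℝ} {c : ℝ} (h : UnifPhase Ψ c) (i : ι)
    (x : ℝ) (hx : |x| ≤ 1) : c / 2 ≤ phaseQuotient (Ψ i) x := by
  have hc := (h.unifSmooth.deriv.deriv.1 i).continuous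
  have h1 : ∫ θ in (0 : ℝ)..1, (1 - θ) * c ≤ phaseQuotient (Ψ i) x := by
    refine intervalIntegral.integral_mono_on zero_le_one
      (Continuous.intervalIntegrable (by fun_prop) _ _)
      (Continuous.intervalIntegrable (by fun_prop) _ _) fun θ hθ => ?_
    refine mul_le_mul_of_nonneg_left (h.le_deriv2 i _ ?_) (by linarith [hθ.2])
    rw [abs_mul, abs_of_nonneg hθ.1]
    nlinarith [hθ.2, hθ.1, abs_nonneg x]
  rw [intervalIntegral.integral_mul_const, integral_one_sub] at h1
  linarith

theorem phaseQuotient_zero (Ψ : ℝ → ℝ) : phaseQuotient Ψ 0 = deriv (deriv Ψ) 0 / 2 := by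
  unfold phaseQuotient
  simp only [mul_zero]
  rw [intervalIntegral.integral_mul_const, integral_one_sub]
  ring

/-- The coefficients of the expansion of `√M ∫ exp (-M Ψ) Ψ''` in powers of `1 / M`. -/
noncomputable def phaseExpansion (Ψ : ℝ → ℝ) (k : ℕ) : ℝ :=
  laplaceCoeff (phaseQuotient Ψ) (deriv (deriv Ψ)) (2 * k)

theorem phaseExpansion_zero {Ψ : ℝ → ℝ} (h : 0 < deriv (deriv Ψ) 0) :
    phaseExpansion Ψ 0 = √(2 * π) * √(deriv (deriv Ψ) 0) := by
  have h1 : √(deriv (deriv Ψ) 0) ≠ 0 := (sqrt_pos.2 h).ne'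
  rw [phaseExpansion, mul_zero, laplaceCoeff_zero, phaseQuotient_zero,
    show π / (deriv (deriv Ψ) 0 / 2) = (2 * π) / deriv (deriv Ψ) 0 by field_simp,
    sqrt_div (by positivity)]
  nth_rewrite 2 [← mul_self_sqrt h.le]
  field_simp

theorem sum_range_two_mul_of_odd {f : ℕ → ℝ} (hf : ∀ n, Odd n → f n = 0) (K : ℕ) :
    ∑ n ∈ Finset.range (2 * K), f n = ∑ k ∈ Finset.range K, f (2 * k) := by
  induction K with
  | zero => simp
  | succ K ih =>
    rw [Finset.sum_range_succ, ← ih, show 2 * (K + 1) = 2 * K + 1 + 1 by ring,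
      Finset.sum_range_succ, Finset.sum_range_succ, hf (2 * K + 1) ⟨K, rfl⟩, add_zero]

theorem UnifPhase.exists_bound_expansion {ι : Type*} {Ψ : ι → ℝ → ℝ} {c : ℝ} (h : UnifPhase Ψ c)
    (k : ℕ) : ∃ D : ℝ, ∀ i, |phaseExpansion (Ψ i) k| ≤ D :=
  exists_abs_laplaceCoeff_le h.unifSmooth_quotient h.unifSmooth.deriv.deriv (half_pos h.pos)
    h.le_quotient (2 * k)

/-- Laplace's method, uniformly over a family of phases. -/
theorem UnifPhase.exists_expansion {ι : Type*} {Ψ : ι → ℝ → ℝ} {c : ℝ} (h : UnifPhase Ψ c)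
    (R : ℕ) : ∃ C : ℝ, ∀ i, ∀ M : ℝ, 0 < M →
      |√M * (∫ x in (-1 : ℝ)..1, exp (-(M * Ψ i x)) * deriv (deriv (Ψ i)) x)
        - ∑ k ∈ Finset.range (R + 1), phaseExpansion (Ψ i) k / M ^ k| ≤ C / M ^ (R + 1) := by
  -- With `ε = 1 / √M`, order `2 (R + 1)` in `ε` is order `R + 1` in `1 / M`.
  obtain ⟨C, hC⟩ := exists_laplace_rescaled h.unifSmooth_quotient h.unifSmooth.deriv.deriv
    (half_pos h.pos) h.le_quotient (2 * (R + 1))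
  refine ⟨C, fun i M hM => ?_⟩
  have hs : 0 < √M := sqrt_pos.2 hM
  set ε : ℝ := 1 / √M with hε
  have hε0 : 0 < ε := by positivity
  have hε2 : ε ^ 2 = 1 / M := by rw [hε, div_pow, one_pow, sq_sqrt hM.le]
  have hp : ∀ k : ℕ, ε ^ (2 * k) = 1 / M ^ k := fun k => by
    rw [pow_mul, hε2, div_pow, one_pow]
  have hCi := hC i ε hε0
  rw [sum_range_two_mul_of_odd (fun n hn => by rw [laplaceCoeff_odd _ _ hn, mul_zero])] at hCi
  have e1 : ∑ k ∈ Finset.range (R + 1), ε ^ (2 * k) *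
      laplaceCoeff (phaseQuotient (Ψ i)) (deriv (deriv (Ψ i))) (2 * k)
      = ∑ k ∈ Finset.range (R + 1), phaseExpansion (Ψ i) k / M ^ k :=
    Finset.sum_congr rfl fun k _ => by rw [hp, phaseExpansion]; ring
  have e2 : (∫ σ in (-(1 / ε))..(1 / ε),
      exp (-(σ ^ 2 * phaseQuotient (Ψ i) (ε * σ))) * deriv (deriv (Ψ i)) (ε * σ))
      = √M * (∫ x in (-1 : ℝ)..1, exp (-(M * Ψ i x)) * deriv (deriv (Ψ i)) x) := by
    have e3 : ∀ σ : ℝ, exp (-(σ ^ 2 * phaseQuotient (Ψ i) (ε * σ))) * deriv (deriv (Ψ i)) (ε * σ)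
        = (fun x => exp (-(M * Ψ i x)) * deriv (deriv (Ψ i)) x) (ε * σ) := by
      intro σ
      have e4 := sq_mul_phaseQuotient (h.unifSmooth.1 i) (h.zero i) (h.deriv_zero i) (ε * σ)
      simp only
      rw [← e4, mul_pow, hε2]
      congr 3
      field_simp
    rw [intervalIntegral.integral_congr fun σ _ => e3 σ,
      intervalIntegral.integral_comp_mul_left
        (fun x => exp (-(M * Ψ i x)) * deriv (deriv (Ψ i)) x) hε0.ne', mul_neg,
      mul_one_div_cancel hε0.ne', smul_eq_mul]
    congr 1
    rw [hε, one_div, inv_inv]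
  rw [e1, e2, hp] at hCi
  rwa [mul_one_div] at hCi

/-! ### Toric potentials and their Legendre transforms -/

/-- The Legendre transform. -/
noncomputable def legendre (U : ℝ → ℝ) (x : ℝ) : ℝ := ⨆ ρ : ℝ, (x * ρ - U ρ)

/-- A smooth strictly convex function whose derivative is a diffeomorphism onto `(0, 1)`. -/
structure ToricPotential (U : ℝ → ℝ) : Prop where
  smooth : ContDiff ℝ ∞ U
  pos : ∀ ρ, 0 < deriv (deriv U) ρ
  tendsto_bot : Tendsto (deriv U) atBot (𝓝 0)
  tendsto_top : Tendsto (deriv U) atTop (𝓝 1)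

namespace ToricPotential

variable {U : ℝ → ℝ} (h : ToricPotential U)
include h

theorem smooth_deriv : ContDiff ℝ ∞ (deriv U) := (contDiff_infty_iff_deriv.1 h.smooth).2

theorem smooth_deriv2 : ContDiff ℝ ∞ (deriv (deriv U)) :=
  (contDiff_infty_iff_deriv.1 h.smooth_deriv).2

theorem hasDerivAt (ρ : ℝ) : HasDerivAt U (deriv U ρ) ρ :=
  (h.smooth.differentiable (by simp)).differentiableAt.hasDerivAt

theorem hasDerivAt_deriv (ρ : ℝ) : HasDerivAt (deriv U) (deriv (deriv U) ρ) ρ :=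
  (h.smooth_deriv.differentiable (by simp)).differentiableAt.hasDerivAt

theorem strictMono : StrictMono (deriv U) := strictMono_of_deriv_pos h.pos

theorem deriv_pos (ρ : ℝ) : 0 < deriv U ρ := by
  have h1 : 0 ≤ deriv U (ρ - 1) := h.strictMono.monotone.le_of_tendsto h.tendsto_bot _
  exact h1.trans_lt (h.strictMono (by linarith))

theorem deriv_lt_one (ρ : ℝ) : deriv U ρ < 1 :=
  (h.strictMono (lt_add_one ρ)).trans_le (h.strictMono.monotone.ge_of_tendsto h.tendsto_top _)

theorem exists_deriv_eq {x : ℝ} (hx : x ∈ Ioo (0 : ℝ) 1) : ∃ ρ, deriv U ρ = x := by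
  refine mem_range_of_exists_le_of_exists_ge h.smooth_deriv.continuous ?_ ?_
  · exact ((h.tendsto_bot.eventually (eventually_lt_nhds hx.1)).exists).imp fun _ => le_of_lt
  · exact ((h.tendsto_top.eventually (eventually_gt_nhds hx.2)).exists).imp fun _ => le_of_lt

theorem tangent_le (ρ₀ ρ : ℝ) : U ρ₀ + deriv U ρ₀ * (ρ - ρ₀) ≤ U ρ := by
  have hc := h.smooth.continuous
  have hd : ∀ s : Set ℝ, DifferentiableOn ℝ U s := fun s =>
    (h.smooth.differentiable (by simp)).differentiableOn
  rcases lt_trichotomy ρ₀ ρ with hlt | rfl | hlt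
  · obtain ⟨ξ, hξ, e⟩ := exists_deriv_eq_slope U hlt hc.continuousOn (hd _)
    have := h.strictMono hξ.1
    rw [eq_div_iff (by linarith)] at e
    nlinarith
  · simp
  · obtain ⟨ξ, hξ, e⟩ := exists_deriv_eq_slope U hlt hc.continuousOn (hd _)
    have := h.strictMono hξ.2
    rw [eq_div_iff (by linarith)] at e
    nlinarith

theorem legendre_deriv (ρ : ℝ) : legendre U (deriv U ρ) = deriv U ρ * ρ - U ρ := by
  have hle : ∀ ρ', deriv U ρ * ρ' - U ρ' ≤ deriv U ρ * ρ - U ρ := fun ρ' => by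
    linarith [h.tangent_le ρ ρ', mul_sub (deriv U ρ) ρ' ρ]
  exact le_antisymm (ciSup_le hle)
    (le_ciSup (f := fun ρ' => deriv U ρ * ρ' - U ρ') ⟨_, forall_mem_range.2 hle⟩ ρ)

/-- The inverse function theorem makes the critical point a differentiable function of the moment
coordinate. Its derivative `1 / U''` becomes the second derivative of the Legendre transform. -/
theorem exists_local_inverse (ρ : ℝ) : ∃ g : ℝ → ℝ, g (deriv U ρ) = ρ ∧
    HasDerivAt g (deriv (deriv U) ρ)⁻¹ (deriv U ρ) ∧
    ∀ᶠ y in 𝓝 (deriv U ρ), deriv U (g y) = y := by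
  have hs : HasStrictDerivAt (deriv U) (deriv (deriv U) ρ) ρ :=
    (h.smooth_deriv.contDiffAt).hasStrictDerivAt' (h.hasDerivAt_deriv ρ) (by simp)
  have hev := hs.eventually_right_inverse (h.pos ρ).ne'
  exact ⟨_, h.strictMono.injective hev.self_of_nhds,
    (hs.to_localInverse (h.pos ρ).ne').hasDerivAt, hev⟩

/-- Near the point the transform is `y * g y - U (g y)`; since `U' (g y) = y`, the terms containing
`g'` cancel. -/
theorem hasDerivAt_legendre (ρ : ℝ) : HasDerivAt (legendre U) ρ (deriv U ρ) := by
  obtain ⟨g, g0, gd, ge⟩ := h.exists_local_inverse ρ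
  have h1 : legendre U =ᶠ[𝓝 (deriv U ρ)] fun y => y * g y - U (g y) := by
    filter_upwards [ge] with y hy
    have := h.legendre_deriv (g y)
    rwa [hy] at this
  have h2 : HasDerivAt (fun y => U (g y)) (deriv U (g (deriv U ρ)) * (deriv (deriv U) ρ)⁻¹)
      (deriv U ρ) := (h.hasDerivAt _).comp _ gd
  rw [g0] at h2
  refine HasDerivAt.congr_of_eventuallyEq ?_ h1
  refine (((hasDerivAt_id _).mul gd).sub h2).congr_deriv ?_
  rw [g0]
  simp

theorem hasDerivAt_deriv_legendre (ρ : ℝ) :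
    HasDerivAt (deriv (legendre U)) (deriv (deriv U) ρ)⁻¹ (deriv U ρ) := by
  obtain ⟨g, g0, gd, ge⟩ := h.exists_local_inverse ρ
  refine gd.congr_of_eventuallyEq ?_
  filter_upwards [ge] with y hy
  have := (h.hasDerivAt_legendre (g y)).deriv
  rwa [hy] at this

theorem iteratedDeriv_two_legendre (ρ : ℝ) :
    iteratedDeriv 2 (legendre U) (deriv U ρ) = (deriv (deriv U) ρ)⁻¹ := by
  rw [iteratedDeriv_succ, iteratedDeriv_one]
  exact (h.hasDerivAt_deriv_legendre ρ).deriv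

theorem integrable_deriv2 : Integrable (deriv (deriv U)) := by
  have hc := h.smooth_deriv2.continuous
  refine integrable_of_intervalIntegral_norm_bounded (l := atTop) (a := fun x : ℝ => -x)
    (b := fun x => x) 1 (fun i => hc.integrableOn_Icc.mono_set Ioc_subset_Icc_self)
    tendsto_neg_atTop_atBot tendsto_id (Eventually.of_forall fun x => ?_)
  simp only [Real.norm_eq_abs, abs_of_pos (h.pos _)]
  rw [intervalIntegral.integral_eq_sub_of_hasDerivAt (fun y _ => h.hasDerivAt_deriv y)
    (hc.intervalIntegrable _ _)]
  linarith [h.deriv_pos (-x), h.deriv_lt_one x]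

theorem integral_deriv2 : ∫ ρ, deriv (deriv U) ρ = 1 := by
  rw [integral_of_hasDerivAt_of_tendsto h.hasDerivAt_deriv h.integrable_deriv2 h.tendsto_bot
    h.tendsto_top, sub_zero]

end ToricPotential

/-! ### The norming constant as a Laplace integral -/

/-- The point where the derivative of `U` takes the value `x`. -/
noncomputable def momentInv (U : ℝ → ℝ) (x : ℝ) : ℝ := Function.invFun (deriv U) x

/-- The phase function of the integral defining the norming constants, centred at its critical
point. -/
noncomputable def toricPhase (U : ℝ → ℝ) (x τ : ℝ) : ℝ :=
  (U (momentInv U x + τ) - U (momentInv U x)) / x - τ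

/-- The norming constant, up to a constant and in logarithmic coordinates. -/
noncomputable def logNorming (U : ℝ → ℝ) (N x : ℝ) : ℝ :=
  (∫ ρ, exp (N * (x * ρ - U ρ)) * deriv (deriv U) ρ) * exp (-(N * legendre U x))

namespace ToricPotential

variable {U : ℝ → ℝ} (h : ToricPotential U) {x : ℝ}
include h

theorem deriv_momentInv (hx : x ∈ Ioo (0 : ℝ) 1) : deriv U (momentInv U x) = x :=
  Function.invFun_eq (h.exists_deriv_eq hx)

theorem hasDerivAt_phase (x τ : ℝ) :
    HasDerivAt (toricPhase U x) (deriv U (momentInv U x + τ) / x - 1) τ := by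
  unfold toricPhase
  exact ((((h.hasDerivAt _).comp_const_add (momentInv U x) τ).sub_const _).div_const x).sub
    (hasDerivAt_id τ)

theorem deriv_phase (x : ℝ) :
    deriv (toricPhase U x) = fun τ => deriv U (momentInv U x + τ) / x - 1 :=
  funext fun τ => (h.hasDerivAt_phase x τ).deriv

theorem deriv2_phase (x : ℝ) : deriv (deriv (toricPhase U x))
    = fun τ => deriv (deriv U) (momentInv U x + τ) / x := by
  rw [h.deriv_phase]
  ext τ
  exact ((((h.hasDerivAt_deriv _).comp_const_add (momentInv U x) τ).div_const x).sub_const 1).deriv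

theorem contDiff_phase (x : ℝ) : ContDiff ℝ ∞ (toricPhase U x) := by
  have := h.smooth
  unfold toricPhase
  fun_prop

/-- From order two on the linear term `-τ` is gone, so bounds on the phase reduce to comparing
derivatives of `U` with `x`. -/
theorem iteratedDeriv_phase (x : ℝ) (k : ℕ) : iteratedDeriv (k + 2) (toricPhase U x)
    = fun τ => iteratedDeriv (k + 2) U (momentInv U x + τ) / x := by
  induction k with
  | zero =>
    rw [iteratedDeriv_succ, iteratedDeriv_succ, iteratedDeriv_zero, h.deriv2_phase,
      iteratedDeriv_succ, iteratedDeriv_succ, iteratedDeriv_zero]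
  | succ k ih =>
    rw [iteratedDeriv_succ, ih]
    ext τ
    have hd : HasDerivAt (iteratedDeriv (k + 2) U) (iteratedDeriv (k + 1 + 2) U
        (momentInv U x + τ)) (momentInv U x + τ) := by
      rw [show k + 1 + 2 = k + 2 + 1 by ring, iteratedDeriv_succ (n := k + 2)]
      have hk : ContDiff ℝ ∞ (iteratedDeriv (k + 2) U) := by
        rw [iteratedDeriv_eq_iterate]
        exact h.smooth.iterate_deriv (k + 2)
      exact (hk.differentiable (by simp)).differentiableAt.hasDerivAt
    exact ((hd.comp_const_add (momentInv U x) τ).div_const x).deriv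

/-- Translation to the critical point absorbs `legendre U x` into the exponent. Factoring out `x`
makes `N * x` the large parameter and turns the density into the second derivative of the phase. -/
theorem logNorming_eq (hx : x ∈ Ioo (0 : ℝ) 1) (N : ℝ) : logNorming U N x
    = x * ∫ τ, exp (-(N * x * toricPhase U x τ)) * deriv (deriv (toricPhase U x)) τ := by
  have hG : legendre U x = x * momentInv U x - U (momentInv U x) := by
    have := h.legendre_deriv (momentInv U x)
    rwa [h.deriv_momentInv hx] at this
  have hx0 : x ≠ 0 := hx.1.ne'
  unfold logNorming
  rw [← integral_add_left_eq_self _ (momentInv U x), ← integral_mul_const, ← integral_const_mul]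
  congr 1
  ext τ
  rw [h.deriv2_phase, hG]
  unfold toricPhase
  rw [mul_right_comm, ← exp_add]
  have e : N * (x * (momentInv U x + τ) - U (momentInv U x + τ))
      + -(N * (x * momentInv U x - U (momentInv U x)))
      = -(N * x * ((U (momentInv U x + τ) - U (momentInv U x)) / x - τ)) := by
    field_simp
    ring
  rw [e]
  field_simp

theorem phase_nonneg (hx : x ∈ Ioo (0 : ℝ) 1) (τ : ℝ) : 0 ≤ toricPhase U x τ := by
  have h1 := h.tangent_le (momentInv U x) (momentInv U x + τ)
  rw [h.deriv_momentInv hx] at h1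
  unfold toricPhase
  rw [sub_nonneg, le_div_iff₀ hx.1]
  linarith

/-- The derivative `U' / x - 1` has the sign of `τ` because `U'` increases. With the antitone half,
this bounds the phase outside `[-1, 1]` by its endpoint values. -/
theorem phase_monotoneOn (hx : x ∈ Ioo (0 : ℝ) 1) : MonotoneOn (toricPhase U x) (Ici 0) := by
  refine monotoneOn_of_deriv_nonneg (convex_Ici 0) (h.contDiff_phase x).continuous.continuousOn
    ((h.contDiff_phase x).differentiable (by simp)).differentiableOn fun τ hτ => ?_
  rw [interior_Ici] at hτ
  rw [h.deriv_phase, sub_nonneg, one_le_div hx.1]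
  nth_rewrite 1 [← h.deriv_momentInv hx]
  exact h.strictMono.monotone (by linarith [mem_Ioi.1 hτ])

theorem phase_antitoneOn (hx : x ∈ Ioo (0 : ℝ) 1) : AntitoneOn (toricPhase U x) (Iic 0) := by
  refine antitoneOn_of_deriv_nonpos (convex_Iic 0) (h.contDiff_phase x).continuous.continuousOn
    ((h.contDiff_phase x).differentiable (by simp)).differentiableOn fun τ hτ => ?_
  rw [interior_Iic] at hτ
  rw [h.deriv_phase, sub_nonpos, div_le_one hx.1]
  nth_rewrite 2 [← h.deriv_momentInv hx]
  exact h.strictMono.monotone (by linarith [mem_Iio.1 hτ])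

/-- The contribution of the complement of `[-1, 1]` to the integral of `logNorming_eq`. -/
theorem tail_bounds (hx : x ∈ Ioo (0 : ℝ) 1) {b M : ℝ} (hM : 0 ≤ M)
    (h1 : b ≤ toricPhase U x 1) (h2 : b ≤ toricPhase U x (-1)) :
    (∫ τ in (-1 : ℝ)..1, exp (-(M * toricPhase U x τ)) * deriv (deriv (toricPhase U x)) τ)
      ≤ ∫ τ, exp (-(M * toricPhase U x τ)) * deriv (deriv (toricPhase U x)) τ ∧
    (∫ τ, exp (-(M * toricPhase U x τ)) * deriv (deriv (toricPhase U x)) τ)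
      ≤ (∫ τ in (-1 : ℝ)..1, exp (-(M * toricPhase U x τ)) * deriv (deriv (toricPhase U x)) τ)
        + exp (-(M * b)) / x := by
  have hpos : ∀ τ, 0 ≤ deriv (deriv (toricPhase U x)) τ := fun τ => by
    rw [h.deriv2_phase]; exact div_nonneg (h.pos _).le hx.1.le
  have hwint : Integrable (deriv (deriv (toricPhase U x))) := by
    rw [h.deriv2_phase]
    exact (h.integrable_deriv2.comp_add_left (momentInv U x)).div_const x
  have hwI : ∫ τ, deriv (deriv (toricPhase U x)) τ = 1 / x := by
    rw [h.deriv2_phase, integral_div, integral_add_left_eq_self (deriv (deriv U)),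
      h.integral_deriv2]
  have hint : Integrable
      (fun τ => exp (-(M * toricPhase U x τ)) * deriv (deriv (toricPhase U x)) τ) := by
    refine hwint.mono' ?_ (Eventually.of_forall fun τ => ?_)
    · have c1 := (h.contDiff_phase x).continuous
      exact (by fun_prop : Continuous fun τ =>
        exp (-(M * toricPhase U x τ))).aestronglyMeasurable.mul hwint.aestronglyMeasurable
    · rw [norm_mul, Real.norm_eq_abs, Real.norm_eq_abs, abs_of_pos (exp_pos _),
        abs_of_nonneg (hpos τ)]
      refine mul_le_of_le_one_left (hpos τ) (exp_le_one_iff.2 ?_)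
      have := mul_nonneg hM (h.phase_nonneg hx τ)
      linarith
  rw [intervalIntegral.integral_of_le (by norm_num : (-1 : ℝ) ≤ 1),
    ← integral_add_compl measurableSet_Ioc hint]
  refine ⟨le_add_of_nonneg_right (integral_nonneg fun τ => mul_nonneg (exp_pos _).le (hpos τ)),
    add_le_add_right ?_ _⟩
  calc ∫ τ in (Ioc (-1 : ℝ) 1)ᶜ,
        exp (-(M * toricPhase U x τ)) * deriv (deriv (toricPhase U x)) τ
      ≤ ∫ τ in (Ioc (-1 : ℝ) 1)ᶜ, exp (-(M * b)) * deriv (deriv (toricPhase U x)) τ := by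
        refine setIntegral_mono_on hint.integrableOn (hwint.const_mul _).integrableOn
          measurableSet_Ioc.compl fun τ hτ => ?_
        refine mul_le_mul_of_nonneg_right (exp_le_exp.2 (neg_le_neg ?_)) (hpos τ)
        refine mul_le_mul_of_nonneg_left ?_ hM
        rw [mem_compl_iff, mem_Ioc, not_and_or, not_lt, not_le] at hτ
        rcases hτ with hτ | hτ
        · exact h2.trans (h.phase_antitoneOn hx (show τ ∈ Iic (0 : ℝ) from by
            simp only [mem_Iic]; linarith) (by simp) hτ)
        · exact h1.trans (h.phase_monotoneOn hx (by simp) (show τ ∈ Ici (0 : ℝ) from by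
            simp only [mem_Ici]; linarith) hτ.le)
    _ ≤ ∫ τ, exp (-(M * b)) * deriv (deriv (toricPhase U x)) τ :=
        setIntegral_le_integral (hwint.const_mul _)
          (Eventually.of_forall fun τ => mul_nonneg (exp_pos _).le (hpos τ))
    _ = exp (-(M * b)) / x := by rw [integral_const_mul, hwI, mul_one_div]

end ToricPotential

/-- The expansion alone gives no positivity for bounded `M`, but the quotient needs a denominator
bounded below for all `M ≥ 1`. -/
theorem UnifPhase.exists_lower_bound {ι : Type*} {Ψ : ι → ℝ → ℝ} {c : ℝ} (h : UnifPhase Ψ c) :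
    ∃ ℓ : ℝ, 0 < ℓ ∧ ∀ i, ∀ M : ℝ, 1 ≤ M →
      ℓ ≤ √M * ∫ x in (-1 : ℝ)..1, exp (-(M * Ψ i x)) * deriv (deriv (Ψ i)) x := by
  obtain ⟨D, hD⟩ := h.unifSmooth_quotient.2 0
  simp only [iteratedDeriv_zero] at hD
  have hc := h.pos
  -- On `|x| ≤ 1 / √M`, a window of length `2 / √M`, one has `M Ψ ≤ D` and `Ψ'' ≥ c`.
  refine ⟨2 * c * exp (-D), by positivity, fun i M hM => ?_⟩
  have hM0 : 0 < M := by linarith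
  have hs : 0 < √M := sqrt_pos.2 hM0
  have hs1 : 1 ≤ √M := one_le_sqrt.2 hM
  have hδ : 1 / √M ≤ 1 := (div_le_one hs).2 hs1
  have hδ0 : 0 < 1 / √M := by positivity
  have hcont : Continuous fun x => exp (-(M * Ψ i x)) * deriv (deriv (Ψ i)) x := by
    have h1 := (h.unifSmooth.1 i).continuous
    have h2 := (h.unifSmooth.deriv.deriv.1 i).continuous
    fun_prop
  have hnn : ∀ x, |x| ≤ 1 → 0 ≤ exp (-(M * Ψ i x)) * deriv (deriv (Ψ i)) x := fun x hx =>
    mul_nonneg (exp_pos _).le (h.pos.le.trans (h.le_deriv2 i x hx))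
  have h1 : ∫ x in (-(1 / √M))..(1 / √M), exp (-D) * c
      ≤ ∫ x in (-(1 / √M))..(1 / √M), exp (-(M * Ψ i x)) * deriv (deriv (Ψ i)) x := by
    refine intervalIntegral.integral_mono_on (by linarith) intervalIntegrable_const
      (hcont.intervalIntegrable _ _) fun x hx => ?_
    have hx' : |x| ≤ 1 / √M := abs_le.2 hx
    have hx1 : |x| ≤ 1 := hx'.trans hδ
    refine mul_le_mul (exp_le_exp.2 (neg_le_neg ?_)) (h.le_deriv2 i x hx1) h.pos.le (exp_pos _).le
    rw [← sq_mul_phaseQuotient (h.unifSmooth.1 i) (h.zero i) (h.deriv_zero i) x]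
    have h2 : M * x ^ 2 ≤ 1 := by
      rw [← sq_abs]
      calc M * |x| ^ 2 ≤ M * (1 / √M) ^ 2 := by gcongr
        _ = 1 := by rw [div_pow, sq_sqrt hM0.le, one_pow]; field_simp
    have h3 := hD i x hx1
    have h4 : 0 ≤ D := (abs_nonneg _).trans h3
    calc M * (x ^ 2 * phaseQuotient (Ψ i) x) = (M * x ^ 2) * phaseQuotient (Ψ i) x := by ring
      _ ≤ (M * x ^ 2) * D := by gcongr; exact (le_abs_self _).trans h3
      _ ≤ 1 * D := by gcongr
      _ = D := one_mul D
  have h2 := intervalIntegral.integral_mono_interval (a := -(1 / √M)) (b := 1 / √M) (c := -1)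
    (d := 1) (μ := volume) (by linarith) (by linarith) hδ
    (f := fun x => exp (-(M * Ψ i x)) * deriv (deriv (Ψ i)) x)
    ((ae_restrict_iff' measurableSet_Ioc).2 (Eventually.of_forall fun x hx =>
      hnn x (abs_le.2 ⟨hx.1.le, hx.2⟩))) (hcont.intervalIntegrable _ _)
  rw [intervalIntegral.integral_const, smul_eq_mul] at h1
  calc 2 * c * exp (-D) = √M * ((1 / √M - -(1 / √M)) * (exp (-D) * c)) := by
        field_simp; ring
    _ ≤ _ := by gcongr; exact h1.trans h2

/-! ### Uniformity up to the boundary of the moment interval -/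

/-- A family of toric potentials, uniformly controlled in terms of `exp ρ` as `ρ → -∞`. -/
structure UniformPotential {ι : Type*} (U : ι → ℝ → ℝ) : Prop where
  toric : ∀ i, ToricPotential (U i)
  bound : ∀ (R : ℝ) (k : ℕ), ∃ C : ℝ, ∀ i ρ, ρ ≤ R → |iteratedDeriv (k + 1) (U i) ρ| ≤ C * exp ρ
  lower : ∀ R : ℝ, ∃ c : ℝ, 0 < c ∧ ∀ i ρ, ρ ≤ R → c * exp ρ ≤ deriv (deriv (U i)) ρ
  top : ∃ R : ℝ, ∀ i, 2 / 3 ≤ deriv (U i) R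

namespace UniformPotential

variable {ι : Type*} {U : ι → ℝ → ℝ} (h : UniformPotential U)
include h

/-- The lower bound for `U''` is integrated from `-∞`, where both `U'` and `exp` tend to zero. -/
theorem exists_lower_deriv (R : ℝ) :
    ∃ c : ℝ, 0 < c ∧ ∀ i ρ, ρ ≤ R → c * exp ρ ≤ deriv (U i) ρ := by
  obtain ⟨c, hc, hl⟩ := h.lower R
  refine ⟨c, hc, fun i ρ hρ => ?_⟩
  have hd : ∀ ρ, HasDerivAt (fun ρ => deriv (U i) ρ - c * exp ρ)
      (deriv (deriv (U i)) ρ - c * exp ρ) ρ := fun ρ =>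
    ((h.toric i).hasDerivAt_deriv ρ).sub ((hasDerivAt_exp ρ).const_mul c)
  have hm : MonotoneOn (fun ρ => deriv (U i) ρ - c * exp ρ) (Iic R) := by
    refine monotoneOn_of_deriv_nonneg (convex_Iic R)
      (fun ρ _ => (hd ρ).continuousAt.continuousWithinAt)
      (fun ρ _ => (hd ρ).differentiableAt.differentiableWithinAt) fun ρ' hρ' => ?_
    rw [(hd ρ').deriv, sub_nonneg]
    exact hl i ρ' (mem_Iic.1 (interior_subset hρ'))
  have ht : Tendsto (fun ρ => deriv (U i) ρ - c * exp ρ) atBot (𝓝 0) := by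
    simpa using (h.toric i).tendsto_bot.sub (tendsto_exp_atBot.const_mul c)
  have := le_of_tendsto ht (b := deriv (U i) ρ - c * exp ρ) (by
    filter_upwards [eventually_le_atBot ρ] with ρ' hρ'
    exact hm (hρ'.trans hρ : ρ' ≤ R) hρ hρ')
  linarith

/-- Restricting to `x ≤ 2 / 3` keeps the critical points below a fixed `R`. There both `x = U'(ρ)`
and `U''(ρ + τ)` with `|τ| ≤ 1` are comparable with `exp ρ`, so these exponentials cancel in the
derivatives of the phase. -/
theorem exists_unifPhase : ∃ c : ℝ,
    UnifPhase (fun q : ι × Ioc (0 : ℝ) (2 / 3) => toricPhase (U q.1) q.2) c := by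
  obtain ⟨R, hR⟩ := h.top
  have hmem : ∀ x : Ioc (0 : ℝ) (2 / 3), (x : ℝ) ∈ Ioo (0 : ℝ) 1 := fun x =>
    ⟨x.2.1, x.2.2.trans_lt (by norm_num)⟩
  have hle : ∀ i (x : Ioc (0 : ℝ) (2 / 3)), momentInv (U i) x ≤ R := fun i x => by
    rw [← (h.toric i).strictMono.le_iff_le, (h.toric i).deriv_momentInv (hmem x)]
    exact x.2.2.trans (hR i)
  obtain ⟨c₁, hc₁, hl₁⟩ := h.exists_lower_deriv R
  obtain ⟨c₂, hc₂, hl₂⟩ := h.lower (R + 1)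
  choose C hC using h.bound (R + 1)
  have hsm : ∀ i ρ, deriv (U i) ρ = iteratedDeriv (0 + 1) (U i) ρ := fun i ρ => by
    rw [zero_add, iteratedDeriv_one]
  -- comparison of `x` with `exp ρ` at the critical point
  have hxl : ∀ i (x : Ioc (0 : ℝ) (2 / 3)), c₁ * exp (momentInv (U i) x) ≤ x := fun i x => by
    have := hl₁ i _ (hle i x)
    rwa [(h.toric i).deriv_momentInv (hmem x)] at this
  have hxu : ∀ i (x : Ioc (0 : ℝ) (2 / 3)), x ≤ C 0 * exp (momentInv (U i) x) := fun i x => by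
    have := hC 0 i (momentInv (U i) x) (by linarith [hle i x])
    rw [← hsm, (h.toric i).deriv_momentInv (hmem x), abs_of_pos x.2.1] at this
    exact this
  have hq : ∀ k i (x : Ioc (0 : ℝ) (2 / 3)) τ, |τ| ≤ 1 →
      |iteratedDeriv (k + 1) (U i) (momentInv (U i) x + τ) / x| ≤ |C k| * exp 1 / c₁ := by
    intro k i x τ hτ
    obtain ⟨h1, h2⟩ := abs_le.1 hτ
    have hx0 : (0 : ℝ) < x := x.2.1
    have h3 := hC k i (momentInv (U i) x + τ) (by linarith [hle i x])
    rw [abs_div, abs_of_pos hx0, div_le_div_iff₀ hx0 hc₁]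
    calc _ ≤ (|C k| * exp (momentInv (U i) x + 1)) * c₁ := by
          refine mul_le_mul_of_nonneg_right (h3.trans ?_) hc₁.le
          exact mul_le_mul (le_abs_self _) (exp_le_exp.2 (by linarith)) (exp_pos _).le
            (abs_nonneg _)
      _ = |C k| * exp 1 * (c₁ * exp (momentInv (U i) x)) := by rw [exp_add]; ring
      _ ≤ |C k| * exp 1 * x := by gcongr; exact hxl i x
  have hzero : ∀ q : ι × Ioc (0 : ℝ) (2 / 3), toricPhase (U q.1) q.2 0 = 0 := fun q => by
    simp [toricPhase]
  have hd1 : ∀ (q : ι × Ioc (0 : ℝ) (2 / 3)) τ, |τ| ≤ 1 →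
      |deriv (toricPhase (U q.1) q.2) τ| ≤ |C 0| * exp 1 / c₁ + 1 := fun q τ hτ => by
    rw [(h.toric q.1).deriv_phase]
    refine (abs_sub _ _).trans ?_
    rw [abs_one, hsm]
    linarith [hq 0 q.1 q.2 τ hτ]
  have hC0 : 0 < |C 0| + 1 := by positivity
  -- The factor `exp (-1)` is the loss from `τ ≥ -1`; the denominator bounds `x / exp ρ`, with `+ 1`
  -- ensuring positivity.
  refine ⟨c₂ * exp (-1) / (|C 0| + 1), ⟨⟨fun q => (h.toric q.1).contDiff_phase _, fun k => ?_⟩,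
    hzero, fun q => ?_, by positivity, fun q τ hτ => ?_⟩⟩
  -- Orders 0 and 1 are separate because the term `-τ` still contributes; order 0 follows from order
  -- 1 and vanishing at the origin.
  · match k with
    | 0 =>
      refine ⟨|C 0| * exp 1 / c₁ + 1, fun q τ hτ => ?_⟩
      rw [iteratedDeriv_zero]
      have hmv := (convex_Icc (-1 : ℝ) 1).norm_image_sub_le_of_norm_deriv_le
        (f := toricPhase (U q.1) q.2) (C := |C 0| * exp 1 / c₁ + 1)
        (fun y _ => ((h.toric q.1).hasDerivAt_phase _ y).differentiableAt)
        (fun y hy => hd1 q y (abs_le.2 hy))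
        (show (0 : ℝ) ∈ Icc (-1 : ℝ) 1 by simp) (show τ ∈ Icc (-1 : ℝ) 1 from abs_le.1 hτ)
      rw [hzero, sub_zero, sub_zero, Real.norm_eq_abs, Real.norm_eq_abs] at hmv
      exact hmv.trans (mul_le_of_le_one_right (by positivity) hτ)
    | 1 =>
      refine ⟨|C 0| * exp 1 / c₁ + 1, fun q τ hτ => ?_⟩
      rw [iteratedDeriv_one]
      exact hd1 q τ hτ
    | k + 2 =>
      refine ⟨|C (k + 1)| * exp 1 / c₁, fun q τ hτ => ?_⟩
      rw [(h.toric q.1).iteratedDeriv_phase]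
      exact hq (k + 1) q.1 q.2 τ hτ
  · rw [(h.toric q.1).deriv_phase]
    simp only [add_zero]
    rw [(h.toric q.1).deriv_momentInv (hmem q.2),
      div_self (hmem q.2).1.ne', sub_self]
  · obtain ⟨h1, h2⟩ := abs_le.1 hτ
    rw [(h.toric q.1).deriv2_phase, div_le_div_iff₀ hC0 (hmem q.2).1]
    have h3 := hl₂ q.1 (momentInv (U q.1) q.2 + τ) (by linarith [hle q.1 q.2])
    have h4 := hxu q.1 q.2
    calc c₂ * exp (-1) * q.2 ≤ c₂ * exp (-1) * ((|C 0| + 1) * exp (momentInv (U q.1) q.2)) := by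
          gcongr
          refine h4.trans ?_
          gcongr
          linarith [le_abs_self (C 0)]
      _ = c₂ * exp (momentInv (U q.1) q.2 + -1) * (|C 0| + 1) := by rw [exp_add]; ring
      _ ≤ deriv (deriv (U q.1)) (momentInv (U q.1) q.2 + τ) * (|C 0| + 1) := by
          gcongr
          refine le_trans ?_ h3
          gcongr

end UniformPotential

/-! ### Uniform expansion of the norming constants -/

theorem exists_exp_neg_mul_le {b : ℝ} (hb : 0 < b) (n : ℕ) :
    ∃ C : ℝ, 0 < C ∧ ∀ M : ℝ, 0 < M → exp (-(M * b)) ≤ C / M ^ n := by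
  refine ⟨n.factorial / b ^ n, by positivity, fun M hM => ?_⟩
  have h := pow_div_factorial_le_exp (M * b) (by positivity) n
  have h1 : 0 < (M * b) ^ n / (n.factorial : ℝ) := by positivity
  rw [exp_neg]
  refine (inv_anti₀ h1 h).trans (le_of_eq ?_)
  rw [mul_pow]
  field_simp

/-- The expansion coefficients of the norming constants. -/
noncomputable def normingCoeff (U : ℝ → ℝ) (k : ℕ) (x : ℝ) : ℝ := phaseExpansion (toricPhase U x) k

namespace UniformPotential

variable {ι : Type*} {U : ι → ℝ → ℝ} (h : UniformPotential U)
include h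

/-- The second derivative of the phase at its critical point is `U'' / x`, and `U''` there is the
inverse of the second derivative of the Legendre transform. -/
theorem normingCoeff_zero (i : ι) {x : ℝ} (hx : x ∈ Ioc (0 : ℝ) (2 / 3)) :
    normingCoeff (U i) 0 x = √(2 * π) * √(1 / (x * iteratedDeriv 2 (legendre (U i)) x)) := by
  have hx' : x ∈ Ioo (0 : ℝ) 1 := ⟨hx.1, hx.2.trans_lt (by norm_num)⟩
  have e := (h.toric i).iteratedDeriv_two_legendre (momentInv (U i) x)
  rw [(h.toric i).deriv_momentInv hx'] at e
  have e2 : deriv (deriv (toricPhase (U i) x)) 0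
      = 1 / (x * iteratedDeriv 2 (legendre (U i)) x) := by
    rw [(h.toric i).deriv2_phase, e]
    simp only [add_zero]
    field_simp
  rw [normingCoeff, phaseExpansion_zero, e2]
  rw [(h.toric i).deriv2_phase]
  exact div_pos ((h.toric i).pos _) hx.1

theorem exists_bound_normingCoeff (k : ℕ) :
    ∃ D : ℝ, ∀ i, ∀ x ∈ Ioc (0 : ℝ) (2 / 3), |normingCoeff (U i) k x| ≤ D := by
  obtain ⟨c, hc⟩ := h.exists_unifPhase
  obtain ⟨D, hD⟩ := hc.exists_bound_expansion k
  exact ⟨D, fun i x hx => hD (i, ⟨x, hx⟩)⟩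

theorem exists_lower_normingCoeff_zero :
    ∃ β : ℝ, 0 < β ∧ ∀ i, ∀ x ∈ Ioc (0 : ℝ) (2 / 3), β ≤ normingCoeff (U i) 0 x := by
  obtain ⟨c, hc⟩ := h.exists_unifPhase
  refine ⟨√(2 * π) * √c, mul_pos (sqrt_pos.2 (by positivity)) (sqrt_pos.2 hc.pos),
    fun i x hx => ?_⟩
  have h1 := hc.le_deriv2 (i, ⟨x, hx⟩) 0 (by simp)
  rw [normingCoeff, phaseExpansion_zero (hc.pos.trans_le h1)]
  gcongr

/-- The norming constants are bounded below. -/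
theorem exists_lower_logNorming : ∃ ℓ : ℝ, 0 < ℓ ∧ ∀ i, ∀ x ∈ Ioc (0 : ℝ) (2 / 3), ∀ N : ℝ,
    1 ≤ N * x → ℓ ≤ √(N * x) * (logNorming (U i) N x / x) := by
  obtain ⟨c, hc⟩ := h.exists_unifPhase
  obtain ⟨ℓ, hℓ0, hℓ⟩ := hc.exists_lower_bound
  refine ⟨ℓ, hℓ0, fun i x hx N hN => ?_⟩
  have hx' : x ∈ Ioo (0 : ℝ) 1 := ⟨hx.1, hx.2.trans_lt (by norm_num)⟩
  rw [(h.toric i).logNorming_eq hx', mul_div_cancel_left₀ _ hx.1.ne']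
  refine (hℓ (i, ⟨x, hx⟩) _ hN).trans ?_
  gcongr
  exact ((h.toric i).tail_bounds hx' (by linarith : 0 ≤ N * x)
    (b := min (toricPhase (U i) x 1) (toricPhase (U i) x (-1))) (min_le_left _ _)
    (min_le_right _ _)).1

/-- The uniform asymptotic expansion of the norming constants. -/
theorem exists_expansion_logNorming (R : ℕ) : ∃ C : ℝ, ∀ i, ∀ x ∈ Ioc (0 : ℝ) (2 / 3), ∀ N : ℝ,
    1 ≤ N * x → 1 / x ≤ (N * x) ^ 3 →
      |√(N * x) * (logNorming (U i) N x / x)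
        - ∑ k ∈ Finset.range (R + 1), normingCoeff (U i) k x / (N * x) ^ k|
      ≤ C / (N * x) ^ (R + 1) := by
  obtain ⟨c, hc⟩ := h.exists_unifPhase
  obtain ⟨C, hC⟩ := hc.exists_expansion R
  -- Of the four extra powers, three pay for `1 / x ≤ M ^ 3` and one for `√M ≤ M`.
  obtain ⟨E, hE0, hE⟩ := exists_exp_neg_mul_le (half_pos hc.pos) (R + 1 + 4)
  refine ⟨C + E, fun i x hx N hN hNx => ?_⟩
  have hx' : x ∈ Ioo (0 : ℝ) 1 := ⟨hx.1, hx.2.trans_lt (by norm_num)⟩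
  set M := N * x with hM
  have hM0 : 0 < M := by linarith
  have h1 := hC (i, ⟨x, hx⟩) M hM0
  simp only [← normingCoeff.eq_1] at h1
  have hend : ∀ y : ℝ, |y| = 1 → c / 2 ≤ toricPhase (U i) x y := fun y hy => by
    have e1 := hc.le_quotient (i, ⟨x, hx⟩) y hy.le
    have e2 := sq_mul_phaseQuotient (hc.unifSmooth.1 (i, ⟨x, hx⟩)) (hc.zero (i, ⟨x, hx⟩))
      (hc.deriv_zero (i, ⟨x, hx⟩)) y
    rw [← sq_abs, hy, one_pow, one_mul] at e2
    exact e1.trans e2.le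
  obtain ⟨t1, t2⟩ := (h.toric i).tail_bounds hx' hM0.le (hend 1 (by simp)) (hend (-1) (by simp))
  rw [(h.toric i).logNorming_eq hx', mul_div_cancel_left₀ _ hx.1.ne', ← hM]
  have hs : √M ≤ M := sqrt_le_iff.2 ⟨hM0.le, by nlinarith⟩
  have ht : √M * (exp (-(M * (c / 2))) / x) ≤ E / M ^ (R + 1) := by
    calc √M * (exp (-(M * (c / 2))) / x) = √M * (exp (-(M * (c / 2))) * (1 / x)) := by ring
      _ ≤ M * (E / M ^ (R + 1 + 4) * M ^ 3) := by
          have := hx.1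
          gcongr
          exact hE M hM0
      _ = E / M ^ (R + 1) := by
          rw [pow_add]; field_simp
  rw [abs_le] at h1 ⊢
  have hs0 : 0 ≤ √M := sqrt_nonneg M
  have m1 := mul_le_mul_of_nonneg_left t1 hs0
  have m2 := mul_le_mul_of_nonneg_left t2 hs0
  rw [mul_add] at m2
  have hE1 : 0 ≤ E / M ^ (R + 1) := by positivity
  rw [add_div]
  constructor <;> linarith [h1.1, h1.2]

end UniformPotential

/-! ### Smooth dependence on the time parameter -/

section Parametric

variable {E : Type*} [NormedAddCommGroup E] [NormedSpace ℝ E]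

/-- At `t = 0` or `t = 1` only derivatives within the slab are available, but each slice fills all
of `E`, so the derivative along it is unrestricted. -/
theorem hasFDerivAt_snd_of_contDiffOn {g : ℝ → E → ℝ}
    (hg : ContDiffOn ℝ ∞ (fun p : ℝ × E => g p.1 p.2) (Icc 0 1 ×ˢ univ)) {t : ℝ}
    (ht : t ∈ Icc (0 : ℝ) 1) (z : E) :
    HasFDerivAt (g t) ((fderivWithin ℝ (fun p : ℝ × E => g p.1 p.2) (Icc 0 1 ×ˢ univ) (t, z)).comp
      (ContinuousLinearMap.inr ℝ ℝ E)) z := by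
  have h1 := ((hg.differentiableOn (by simp)) (t, z) ⟨ht, mem_univ z⟩).hasFDerivWithinAt
  have h2 : HasFDerivWithinAt (fun z : E => (t, z)) (ContinuousLinearMap.inr ℝ ℝ E) univ z :=
    (hasFDerivAt_prodMk_right t z).hasFDerivWithinAt
  exact (h1.comp z h2 fun y _ => ⟨ht, mem_univ y⟩).hasFDerivAt univ_mem

theorem contDiffOn_fderiv_snd {g : ℝ → E → ℝ}
    (hg : ContDiffOn ℝ ∞ (fun p : ℝ × E => g p.1 p.2) (Icc 0 1 ×ˢ univ)) (v : E) :
    ContDiffOn ℝ ∞ (fun p : ℝ × E => fderiv ℝ (g p.1) p.2 v) (Icc 0 1 ×ˢ univ) := by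
  have hS : UniqueDiffOn ℝ (Icc (0 : ℝ) 1 ×ˢ (univ : Set E)) :=
    (uniqueDiffOn_Icc zero_lt_one).prod uniqueDiffOn_univ
  have h1 : ContDiffOn ℝ ∞ (fderivWithin ℝ (fun p : ℝ × E => g p.1 p.2) (Icc 0 1 ×ˢ univ))
      (Icc 0 1 ×ˢ univ) := hg.fderivWithin hS (by simp)
  refine (h1.clm_apply (contDiffOn_const (c := ((0 : ℝ), v)))).congr fun p hp => ?_
  have := (hasFDerivAt_snd_of_contDiffOn hg hp.1 p.2).fderiv
  rw [this]
  rfl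

theorem contDiff_snd_of_contDiffOn {g : ℝ → E → ℝ}
    (hg : ContDiffOn ℝ ∞ (fun p : ℝ × E => g p.1 p.2) (Icc 0 1 ×ˢ univ)) {t : ℝ}
    (ht : t ∈ Icc (0 : ℝ) 1) : ContDiff ℝ ∞ (g t) := by
  rw [← contDiffOn_univ]
  exact hg.comp (contDiff_prodMk_right t).contDiffOn fun z _ => ⟨ht, mem_univ z⟩

theorem contDiffOn_deriv_snd {g : ℝ → ℝ → ℝ}
    (hg : ContDiffOn ℝ ∞ (fun p : ℝ × ℝ => g p.1 p.2) (Icc 0 1 ×ˢ univ)) :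
    ContDiffOn ℝ ∞ (fun p : ℝ × ℝ => deriv (g p.1) p.2) (Icc 0 1 ×ˢ univ) := by
  simpa only [fderiv_apply_one_eq_deriv] using contDiffOn_fderiv_snd hg 1

end Parametric

/-! ### Even families near a pole -/

/-- The operator `(r / 2) ∂/∂r`, which is `∂/∂ρ` in the coordinate `r = exp (ρ / 2)`. -/
noncomputable def eulerOp (g : ℝ → ℝ → ℝ) (t r : ℝ) : ℝ := r / 2 * deriv (g t) r

/-- A smooth family of functions on the line, with vanishing derivative at the origin. -/
structure EvenFamily (g : ℝ → ℝ → ℝ) : Prop where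
  smooth : ContDiffOn ℝ ∞ (fun p : ℝ × ℝ => g p.1 p.2) (Icc 0 1 ×ˢ univ)
  deriv_zero : ∀ t ∈ Icc (0 : ℝ) 1, deriv (g t) 0 = 0

namespace EvenFamily

variable {g : ℝ → ℝ → ℝ} (h : EvenFamily g)
include h

theorem contDiff {t : ℝ} (ht : t ∈ Icc (0 : ℝ) 1) : ContDiff ℝ ∞ (g t) :=
  contDiff_snd_of_contDiffOn h.smooth ht

theorem eulerOp : EvenFamily (eulerOp g) := by
  refine ⟨?_, fun t ht => ?_⟩
  · have := contDiffOn_deriv_snd h.smooth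
    unfold ToricCP1.eulerOp
    exact (contDiff_snd.div_const 2).contDiffOn.mul this
  · have hd := (contDiff_infty_iff_deriv.1 (h.contDiff ht)).2
    have h1 : HasDerivAt (deriv (g t)) (deriv (deriv (g t)) 0) 0 :=
      (hd.differentiable (by simp)).differentiableAt.hasDerivAt
    have h2 := ((hasDerivAt_id (0 : ℝ)).div_const 2).mul h1
    have h3 : HasDerivAt (ToricCP1.eulerOp g t) _ 0 := h2
    rw [h3.deriv, h.deriv_zero t ht]
    simp

/-- The constant and linear Taylor coefficients at `0` vanish, and the second derivative is bounded
on a compact set of `(t, r)`. -/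
theorem exists_bound (h0 : ∀ t ∈ Icc (0 : ℝ) 1, g t 0 = 0) (T : ℝ) :
    ∃ C : ℝ, ∀ t ∈ Icc (0 : ℝ) 1, ∀ r, |r| ≤ T → |g t r| ≤ C * r ^ 2 := by
  have hc := (contDiffOn_deriv_snd (g := fun t => deriv (g t))
    (contDiffOn_deriv_snd h.smooth)).continuousOn
  obtain ⟨C, hC⟩ := ((isCompact_Icc (a := (0 : ℝ)) (b := 1)).prod
    (isCompact_Icc (a := -T) (b := T))).exists_bound_of_continuousOn
    (hc.mono (prod_mono subset_rfl (subset_univ _)))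
  refine ⟨C, fun t ht r hr => ?_⟩
  have hk : ∀ n, ContDiff ℝ ∞ (iteratedDeriv n (g t)) := fun n => by
    rw [iteratedDeriv_eq_iterate]; exact (h.contDiff ht).iterate_deriv n
  have := abs_sub_taylor_le 2 (g := fun n => iteratedDeriv n (g t)) (B := C) (r := T)
    (fun n x => by
      rw [iteratedDeriv_succ]
      exact ((hk n).differentiable (by simp)).differentiableAt.hasDerivAt)
    (fun x hx => by
      rw [iteratedDeriv_succ, iteratedDeriv_one]
      exact hC (t, x) ⟨ht, abs_le.1 hx⟩) r hr
  simpa [Finset.sum_range_succ, h0 t ht, h.deriv_zero t ht, iteratedDeriv_one] using this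

theorem deriv_comp_exp {t : ℝ} (ht : t ∈ Icc (0 : ℝ) 1) :
    deriv (fun ρ => g t (exp (ρ / 2))) = fun ρ => ToricCP1.eulerOp g t (exp (ρ / 2)) := by
  ext ρ
  have h1 : HasDerivAt (g t) (deriv (g t) (exp (ρ / 2))) (exp (ρ / 2)) :=
    ((h.contDiff ht).differentiable (by simp)).differentiableAt.hasDerivAt
  have h2 : HasDerivAt (fun ρ : ℝ => exp (ρ / 2)) (exp (ρ / 2) * (1 / 2)) ρ :=
    ((hasDerivAt_id ρ).div_const 2).exp
  refine ((h1.comp ρ h2).congr_deriv ?_).deriv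
  unfold ToricCP1.eulerOp
  ring

/-- Each derivative in `ρ` is an application of `eulerOp`, which preserves even families and makes
them vanish at `r = 0`. The quadratic bound in `r = exp (ρ / 2)` is then a bound by `exp ρ`. -/
theorem exists_bound_iteratedDeriv (R : ℝ) (k : ℕ) : ∃ C : ℝ, ∀ t ∈ Icc (0 : ℝ) 1, ∀ ρ, ρ ≤ R →
    |iteratedDeriv (k + 1) (fun ρ => g t (exp (ρ / 2))) ρ| ≤ C * exp ρ := by
  induction k generalizing g with
  | zero =>
    obtain ⟨C, hC⟩ := h.eulerOp.exists_bound (fun t _ => by simp [ToricCP1.eulerOp]) (exp (R / 2))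
    refine ⟨C, fun t ht ρ hρ => ?_⟩
    rw [zero_add, iteratedDeriv_one, h.deriv_comp_exp ht]
    have := hC t ht (exp (ρ / 2)) (by
      rw [abs_of_pos (exp_pos _), exp_le_exp]; linarith)
    rwa [← exp_nat_mul, show ((2 : ℕ) : ℝ) * (ρ / 2) = ρ by push_cast; ring] at this
  | succ k ih =>
    obtain ⟨C, hC⟩ := ih h.eulerOp
    refine ⟨C, fun t ht ρ hρ => ?_⟩
    rw [iteratedDeriv_succ', h.deriv_comp_exp ht]
    exact hC t ht ρ hρ

end EvenFamily

theorem deriv_zero_of_even {f : ℝ → ℝ} (hf : ∀ x, f (-x) = f x) : deriv f 0 = 0 := by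
  have h := deriv_comp_neg f 0
  simp only [hf, neg_zero] at h
  linarith

/-! ### Radial functions in logarithmic coordinates -/

section Radial

theorem hasFDerivAt_log_normSq {z : ℂ} (hz : z ≠ 0) :
    HasFDerivAt (fun ζ : ℂ => log (‖ζ‖ ^ 2)) ((2 / ‖z‖ ^ 2) • innerSL ℝ z) z := by
  have h1 : HasFDerivAt (fun ζ : ℂ => ‖ζ‖ ^ 2) (2 • innerSL ℝ z) z :=
    (hasStrictFDerivAt_norm_sq z).hasFDerivAt
  have h2 := h1.log (by positivity)
  refine h2.congr_fderiv ?_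
  ext v
  simp
  ring

/-- The Laplacian of a radial function in logarithmic coordinates. -/
theorem ddbar_of_radial {f : ℂ → ℝ} {U : ℝ → ℝ} (hU : ContDiff ℝ ∞ U)
    (hf : ∀ z : ℂ, z ≠ 0 → f z = U (log (‖z‖ ^ 2))) {z : ℂ} (hz : z ≠ 0) :
    ddbar f z = deriv (deriv U) (log (‖z‖ ^ 2)) / ‖z‖ ^ 2 := by
  have hd := contDiff_infty_iff_deriv.1 hU
  have hdd := contDiff_infty_iff_deriv.1 hd.2
  have hfd : ∀ ζ : ℂ, ζ ≠ 0 → HasFDerivAt f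
      ((deriv U (log (‖ζ‖ ^ 2)) * (2 / ‖ζ‖ ^ 2)) • innerSL ℝ ζ) ζ := by
    intro ζ hζ
    have h1 := (hd.1 (log (‖ζ‖ ^ 2))).hasDerivAt.comp_hasFDerivAt ζ (hasFDerivAt_log_normSq hζ)
    rw [smul_smul] at h1
    refine h1.congr_of_eventuallyEq ?_
    filter_upwards [isOpen_ne.mem_nhds hζ] with y hy
    exact hf y hy
  have hnear : fderiv ℝ f =ᶠ[𝓝 z]
      fun ζ => (deriv U (log (‖ζ‖ ^ 2)) * (2 / ‖ζ‖ ^ 2)) • innerSL ℝ ζ := by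
    filter_upwards [isOpen_ne.mem_nhds hz] with ζ hζ
    exact (hfd ζ hζ).fderiv
  have hn0 : ‖z‖ ^ 2 ≠ 0 := by positivity
  have c1 := (hdd.1 (log (‖z‖ ^ 2))).hasDerivAt.comp_hasFDerivAt z (hasFDerivAt_log_normSq hz)
  have c2 : HasFDerivAt (fun ζ : ℂ => 2 / ‖ζ‖ ^ 2) ((-2 / (‖z‖ ^ 2) ^ 2) • (2 • innerSL ℝ z)) z := by
    have e := (hasDerivAt_inv hn0).comp_hasFDerivAt z (hasStrictFDerivAt_norm_sq z).hasFDerivAt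
    have e2 := e.const_mul 2
    refine (e2.congr_fderiv ?_)
    ext v
    simp
    ring
  have hsec := (c1.mul c2).smul (innerSL ℝ (E := ℂ)).hasFDerivAt
  have hfd2 := hsec.congr_of_eventuallyEq hnear
  have hq : ‖z‖ ^ 2 = z.re ^ 2 + z.im ^ 2 := by
    rw [← Complex.normSq_eq_norm_sq, Complex.normSq_apply]; ring
  rw [ddbar, InnerProductSpace.laplacian_eq_iteratedFDeriv_complexPlane]
  simp only [iteratedFDeriv_two_apply]
  rw [hfd2.fderiv]
  have hin : ∀ w v : ℂ, innerSL ℝ w v = w.re * v.re + w.im * v.im := fun w v => by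
    rw [innerSL_apply_apply, Complex.inner]
    simp [Complex.mul_re]
    ring
  simp [hin]
  rw [hq] at hn0 ⊢
  field_simp
  ring

end Radial

/-- The integral of a radial function over the plane, in logarithmic coordinates. -/
theorem integral_radial_exp (F : ℝ → ℝ) :
    ∫ z : ℂ, F ‖z‖ = π * ∫ ρ : ℝ, exp ρ * F (exp (ρ / 2)) := by
  rw [integral_fun_norm_addHaar volume F]
  have himg : (fun ρ : ℝ => exp (ρ / 2)) '' univ = Ioi 0 := by
    ext y
    simp only [image_univ, mem_range, mem_Ioi]
    refine ⟨?_, fun hy => ⟨2 * log y, ?_⟩⟩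
    · rintro ⟨ρ, rfl⟩; exact exp_pos _
    · rw [mul_div_cancel_left₀ _ (two_ne_zero), exp_log hy]
  have hcv := integral_image_eq_integral_abs_deriv_smul (s := univ)
    (f := fun ρ : ℝ => exp (ρ / 2)) (f' := fun ρ => exp (ρ / 2) * (1 / 2)) MeasurableSet.univ
    (fun ρ _ => (((hasDerivAt_id ρ).div_const 2).exp).hasDerivWithinAt)
    (fun a _ b _ hab => by
      have := exp_injective hab
      linarith) (fun y => y ^ (Module.finrank ℝ ℂ - 1) • F y)
  rw [himg] at hcv
  rw [hcv, Complex.finrank_real_complex, setIntegral_univ]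
  -- Polar integration contributes `2 * π`, the dimension times the area of the unit disc, and `r dr
  -- = exp ρ dρ / 2`.
  have hball : volume.real (Metric.ball (0 : ℂ) 1) = π := by
    simp [Measure.real, Complex.volume_ball]
  rw [hball]
  simp only [smul_eq_mul, nsmul_eq_mul]
  rw [← integral_const_mul, ← integral_const_mul, ← integral_const_mul]
  congr 1
  ext ρ
  have e : exp ρ = exp (ρ / 2) * exp (ρ / 2) := by rw [← exp_add]; ring_nf
  rw [e, abs_of_pos (by positivity)]
  push_cast
  ring

theorem monomialNormSq_eq {φ : ℂ × ℂ → ℝ} {U : ℝ → ℝ} (hU : ContDiff ℝ ∞ U)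
    (hf : ∀ z : ℂ, z ≠ 0 → chart φ z = U (log (‖z‖ ^ 2))) (N : ℕ) (x : ℝ) :
    monomialNormSq φ N x = 2 * π * ∫ ρ, exp (N * (x * ρ - U ρ)) * deriv (deriv U) ρ := by
  let F : ℝ → ℝ := fun r => r ^ (2 * (N * x)) *
      exp (-(N * U (log (r ^ 2)))) * (2 * (deriv (deriv U) (log (r ^ 2)) / r ^ 2))
  have h1 : monomialNormSq φ N x = ∫ z : ℂ, F ‖z‖ := by
    refine integral_congr_ae ?_
    have : ∀ᵐ z : ℂ, z ≠ 0 := by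
      simp [ae_iff, measure_singleton]
    filter_upwards [this] with z hz
    rw [hf z hz, ddbar_of_radial hU hf hz]
  rw [h1, integral_radial_exp, mul_comm 2 π, mul_assoc, ← integral_const_mul 2]
  congr 2
  ext ρ
  simp only [F]
  have e1 : exp (ρ / 2) ^ 2 = exp ρ := by
    rw [← exp_nat_mul]; congr 1; push_cast; ring
  have e2 : exp (ρ / 2) ^ (2 * (N * x)) = exp (N * (x * ρ)) := by
    rw [← exp_mul]; congr 1; ring
  rw [e1, log_exp, e2, mul_sub, sub_eq_add_neg, exp_add]
  field_simp

/-- A family of potentials given by smooth even families in the coordinates `exp (± ρ / 2)` at the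
two poles. -/
theorem uniformPotential_of_evenFamily {ι : Type*} {s : ι → ℝ} (hs : ∀ i, s i ∈ Icc (0 : ℝ) 1)
    {v w : ℝ → ℝ → ℝ} (hv : EvenFamily v) (hw : EvenFamily w) {U : ι → ℝ → ℝ}
    (hUv : ∀ i ρ, U i ρ = v (s i) (exp (ρ / 2)))
    (hUw : ∀ i ρ, U i ρ = w (s i) (exp (-ρ / 2)) + ρ)
    (hl : ∀ R : ℝ, ∃ c : ℝ, 0 < c ∧ ∀ i ρ, ρ ≤ R → c * exp ρ ≤ deriv (deriv (U i)) ρ) :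
    UniformPotential U := by
  have hU : ∀ i, U i = fun ρ => v (s i) (exp (ρ / 2)) := fun i => funext (hUv i)
  have hb : ∀ (R : ℝ) (k : ℕ), ∃ C : ℝ, ∀ i ρ, ρ ≤ R →
      |iteratedDeriv (k + 1) (U i) ρ| ≤ C * exp ρ := fun R k => by
    obtain ⟨C, hC⟩ := hv.exists_bound_iteratedDeriv R k
    exact ⟨C, fun i ρ hρ => by rw [hU]; exact hC (s i) (hs i) ρ hρ⟩
  obtain ⟨C, hC⟩ := hb 0 0
  obtain ⟨D, hD⟩ := hw.exists_bound_iteratedDeriv 0 0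
  -- In the chart at infinity `U` is an even family evaluated at `-ρ`, plus `ρ`. Its decay gives
  -- both the limit 1 of `U'` and a common point beyond which `U' ≥ 2 / 3`.
  have htop : ∀ i ρ, 0 ≤ ρ → |deriv (U i) ρ - 1| ≤ D * exp (-ρ) := fun i ρ hρ => by
    have h1 := hD (s i) (hs i) (-ρ) (by linarith)
    rw [zero_add, iteratedDeriv_one] at h1
    have h2 : U i = fun ρ => (fun σ => w (s i) (exp (σ / 2))) (-ρ) + ρ := funext (hUw i)
    have h3 : DifferentiableAt ℝ (fun σ => w (s i) (exp (σ / 2))) (-ρ) := by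
      have := (hw.contDiff (hs i)).differentiable (by simp)
      fun_prop
    have h4 : HasDerivAt (U i) (deriv (fun σ => w (s i) (exp (σ / 2))) (-ρ) * -1 + 1) ρ := by
      rw [h2]
      exact (h3.hasDerivAt.comp ρ (hasDerivAt_neg ρ)).add (hasDerivAt_id ρ)
    rw [h4.deriv, add_sub_cancel_right, mul_neg_one, abs_neg]
    exact h1
  refine ⟨fun i => ⟨?_, fun ρ => ?_, ?_, ?_⟩, hb, hl, ?_⟩
  · have := hv.contDiff (hs i)
    rw [hU]
    fun_prop
  · obtain ⟨c, hc, h⟩ := hl ρ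
    exact (mul_pos hc (exp_pos ρ)).trans_le (h i ρ le_rfl)
  · refine squeeze_zero_norm' (a := fun ρ => C * exp ρ) ?_ (by
      simpa using tendsto_exp_atBot.const_mul C)
    filter_upwards [eventually_le_atBot (0 : ℝ)] with ρ hρ
    have := hC i ρ hρ
    rwa [zero_add, iteratedDeriv_one] at this
  · rw [← tendsto_sub_nhds_zero_iff]
    refine squeeze_zero_norm' (a := fun ρ => D * exp (-ρ)) ?_ (by
      simpa using (tendsto_exp_neg_atTop_nhds_zero).const_mul D)
    filter_upwards [eventually_ge_atTop (0 : ℝ)] with ρ hρ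
    exact htop i ρ hρ
  · have ht : Tendsto (fun ρ => D * exp (-ρ)) atTop (𝓝 0) := by
      simpa using (tendsto_exp_neg_atTop_nhds_zero).const_mul D
    obtain ⟨R, hR, hR0⟩ := ((ht.eventually (eventually_lt_nhds (by norm_num : (0 : ℝ) < 1 / 3))).and
      (eventually_ge_atTop 0)).exists
    refine ⟨R, fun i => ?_⟩
    have := (abs_le.1 (htop i R hR0)).1
    linarith

theorem chart_eq_logPotential {φ : ℂ × ℂ → ℝ}
    (hφ : ∀ (c : ℂ) (Z : ℂ × ℂ), ‖c‖ = 1 → Z ≠ 0 → φ (Z.1, c * Z.2) = φ Z) {z : ℂ} (hz : z ≠ 0) :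
    chart φ z = logPotential φ (log (‖z‖ ^ 2)) := by
  have h0 : 0 < ‖z‖ := norm_pos_iff.2 hz
  have h1 : exp (log (‖z‖ ^ 2) / 2) = ‖z‖ := by
    rw [log_pow]
    push_cast
    rw [mul_div_cancel_left₀ _ two_ne_zero, exp_log h0]
  have h2 := hφ (z / ‖z‖) (1, (‖z‖ : ℂ)) (by simp [h0.ne']) (by simp)
  rw [logPotential, h1, chart, chart, ← h2]
  simp only
  rw [div_mul_cancel₀ _ (by exact_mod_cast h0.ne')]

/-! ### Potentials of a geodesic of toric metrics -/

section Geodesic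

variable {φ : ℝ → ℂ × ℂ → ℝ}

theorem IsToricGeodesic.contDiffOn_comp (hφ : IsToricGeodesic φ) {E : Type*}
    [NormedAddCommGroup E] [NormedSpace ℝ E] {f : E → ℂ × ℂ} (hf : ContDiff ℝ ∞ f)
    (h0 : ∀ x, f x ≠ 0) :
    ContDiffOn ℝ ∞ (fun p : ℝ × E => φ p.1 (f p.2)) (Icc 0 1 ×ˢ univ) :=
  hφ.smooth.comp (t := Icc (0 : ℝ) 1 ×ˢ ({0}ᶜ : Set (ℂ × ℂ)))
    (contDiff_fst.prodMk (hf.comp contDiff_snd)).contDiffOn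
    (fun p hp => ⟨hp.1, h0 p.2⟩)

theorem IsToricGeodesic.evenFamily (hφ : IsToricGeodesic φ) :
    EvenFamily (fun t r => φ t (1, (r : ℂ))) := by
  refine ⟨hφ.contDiffOn_comp (f := fun r : ℝ => ((1 : ℂ), (r : ℂ)))
    (contDiff_const.prodMk Complex.ofRealCLM.contDiff) (fun r => by simp), fun t ht => ?_⟩
  refine deriv_zero_of_even fun r => ?_
  have := (hφ.metric t ht).invariant (-1) (1, (r : ℂ)) (by simp) (by simp)
  simpa using this

/-- The circle acts on the second coordinate only. The sign change of the first is that action by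
`-1` combined with homogeneity for `c = -1`, whose logarithmic term is zero. -/
theorem IsToricGeodesic.evenFamily_infty (hφ : IsToricGeodesic φ) :
    EvenFamily (fun t r => φ t ((r : ℂ), 1)) := by
  refine ⟨hφ.contDiffOn_comp (f := fun r : ℝ => ((r : ℂ), (1 : ℂ)))
    (Complex.ofRealCLM.contDiff.prodMk contDiff_const) (fun r => by simp), fun t ht => ?_⟩
  refine deriv_zero_of_even fun r => ?_
  have h1 := (hφ.metric t ht).invariant (-1) (-(r : ℂ), 1) (by simp) (by simp)
  have h2 := (hφ.metric t ht).homogeneous (-1) ((r : ℂ), 1) (by simp) (by simp)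
  simp at h1 h2
  simp [← h1, h2]

theorem continuousOn_ddbar {g : ℝ → ℂ → ℝ}
    (hg : ContDiffOn ℝ ∞ (fun p : ℝ × ℂ => g p.1 p.2) (Icc 0 1 ×ˢ univ)) :
    ContinuousOn (fun p : ℝ × ℂ => ddbar (g p.1) p.2) (Icc 0 1 ×ˢ univ) := by
  have h1 : ∀ v : ℂ, ContinuousOn
      (fun p : ℝ × ℂ => fderiv ℝ (fun ζ => fderiv ℝ (g p.1) ζ v) p.2 v) (Icc 0 1 ×ˢ univ) :=
    fun v => (contDiffOn_fderiv_snd (g := fun t ζ => fderiv ℝ (g t) ζ v)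
      (contDiffOn_fderiv_snd hg v) v).continuousOn
  refine (((h1 1).add (h1 Complex.I)).div_const 4).congr fun p hp => ?_
  have hd : Differentiable ℝ (fderiv ℝ (g p.1)) :=
    ((contDiff_snd_of_contDiffOn hg hp.1).fderiv_right (m := 1) (by norm_cast)).differentiable
      (by simp)
  have h2 : ∀ v : ℂ, fderiv ℝ (fun ζ => fderiv ℝ (g p.1) ζ v) p.2 v
      = fderiv ℝ (fderiv ℝ (g p.1)) p.2 v v := fun v => by
    rw [fderiv_clm_apply (hd p.2) (differentiableAt_const v)]
    simp
  rw [ddbar, InnerProductSpace.laplacian_eq_iteratedFDeriv_complexPlane]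
  simp [iteratedFDeriv_two_apply, h2]

theorem IsToricGeodesic.contDiff_logPotential (hφ : IsToricGeodesic φ) {t : ℝ}
    (ht : t ∈ Icc (0 : ℝ) 1) : ContDiff ℝ ∞ (logPotential (φ t)) := by
  have := hφ.evenFamily.contDiff ht
  exact this.comp (contDiff_exp.comp (contDiff_id.div_const 2))

/-- `U''(ρ)` equals `exp ρ` times the value of `ddbar` at radius `exp (ρ / 2)`, and the positive
continuous function `ddbar` has a positive minimum over `[0, 1]` times a closed disc, pole included.
-/
theorem IsToricGeodesic.exists_lower (hφ : IsToricGeodesic φ) (R : ℝ) :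
    ∃ c : ℝ, 0 < c ∧ ∀ t ∈ Icc (0 : ℝ) 1, ∀ ρ, ρ ≤ R →
      c * exp ρ ≤ deriv (deriv (logPotential (φ t))) ρ := by
  have hg : ContDiffOn ℝ ∞ (fun p : ℝ × ℂ => chart (φ p.1) p.2) (Icc 0 1 ×ˢ univ) :=
    hφ.contDiffOn_comp (f := fun z : ℂ => ((1 : ℂ), z)) (contDiff_const.prodMk contDiff_id)
      (fun r => by simp)
  have hc := continuousOn_ddbar (g := fun t => chart (φ t)) hg
  obtain ⟨p, hp, hmin⟩ := ((isCompact_Icc (a := (0 : ℝ)) (b := 1)).prod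
    (isCompact_closedBall (0 : ℂ) (exp (R / 2)))).exists_isMinOn
    ⟨(0, 0), by simp, by simp [(exp_pos _).le]⟩ (hc.mono (prod_mono subset_rfl (subset_univ _)))
  refine ⟨ddbar (chart (φ p.1)) p.2, (hφ.metric p.1 hp.1).positive p.2, fun t ht ρ hρ => ?_⟩
  have hn : ‖((exp (ρ / 2) : ℝ) : ℂ)‖ = exp (ρ / 2) := by
    rw [Complex.norm_real, Real.norm_eq_abs, abs_of_pos (exp_pos _)]
  have e1 : exp (ρ / 2) ^ 2 = exp ρ := by
    rw [← exp_nat_mul]; congr 1; push_cast; ring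
  have h1 := hmin (show (t, ((exp (ρ / 2) : ℝ) : ℂ)) ∈
      Icc (0 : ℝ) 1 ×ˢ Metric.closedBall (0 : ℂ) (exp (R / 2)) from ⟨ht, by
    rw [mem_closedBall_zero_iff, hn, exp_le_exp]; linarith⟩)
  simp only [mem_ofPred_eq] at h1
  rw [ddbar_of_radial (hφ.contDiff_logPotential ht)
    (fun z hz => chart_eq_logPotential (hφ.metric t ht).invariant hz)
    (by exact_mod_cast (exp_pos _).ne'), hn, e1, log_exp, le_div_iff₀ (exp_pos _)] at h1
  exact h1

theorem IsToricGeodesic.uniformPotential (hφ : IsToricGeodesic φ) :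
    UniformPotential (fun t : Icc (0 : ℝ) 1 => logPotential (φ t)) := by
  refine uniformPotential_of_evenFamily (s := fun t : Icc (0 : ℝ) 1 => (t : ℝ)) (fun t => t.2) hφ.evenFamily
    hφ.evenFamily_infty (fun t ρ => rfl) (fun t ρ => ?_) (fun R => ?_)
  -- Scaling by `exp (ρ / 2)` carries `(exp (-ρ / 2), 1)` to `(1, exp (ρ / 2))` and adds `log (exp
  -- ρ) = ρ`.
  · have h1 := (hφ.metric t t.2).homogeneous ((exp (ρ / 2) : ℝ) : ℂ) (((exp (-ρ / 2) : ℝ) : ℂ), 1)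
      (by exact_mod_cast (exp_pos _).ne') (by simp)
    have e1 : exp (ρ / 2) ^ 2 = exp ρ := by
      rw [← exp_nat_mul]; congr 1; push_cast; ring
    have e2 : ((exp (ρ / 2) : ℝ) : ℂ) * ((exp (-ρ / 2) : ℝ) : ℂ) = 1 := by
      rw [← Complex.ofReal_mul, ← exp_add]
      ring_nf
      simp
    rw [Complex.norm_real, Real.norm_eq_abs, abs_of_pos (exp_pos _), e1, log_exp, Prod.smul_mk,
      smul_eq_mul, smul_eq_mul, mul_one, e2] at h1
    exact h1
  · obtain ⟨c, hc, h⟩ := hφ.exists_lower R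
    exact ⟨c, hc, fun t ρ hρ => h t t.2 ρ hρ⟩

theorem normingConstant_eq {ψ : ℂ × ℂ → ℝ} (hU : ContDiff ℝ ∞ (logPotential ψ))
    (hf : ∀ z : ℂ, z ≠ 0 → chart ψ z = logPotential ψ (log (‖z‖ ^ 2))) (N : ℕ) (x : ℝ) :
    normingConstant ψ N x = 2 * π * logNorming (logPotential ψ) N x := by
  rw [normingConstant, monomialNormSq_eq hU hf, logNorming, mul_assoc]
  rfl

end Geodesic

/-! ### The Fubini–Study metric -/

section Canonical

theorem logPotential_canonicalMetric :
    logPotential canonicalMetric = fun ρ => log (1 + exp ρ) := by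
  ext ρ
  have e1 : exp (ρ / 2) ^ 2 = exp ρ := by
    rw [← exp_nat_mul]; congr 1; push_cast; ring
  rw [logPotential, chart, canonicalMetric]
  simp only [norm_one, one_pow]
  rw [Complex.norm_real, Real.norm_eq_abs, abs_of_pos (exp_pos _), e1]

theorem hasDerivAt_log_one_add_exp (ρ : ℝ) :
    HasDerivAt (fun ρ => log (1 + exp ρ)) (exp ρ / (1 + exp ρ)) ρ :=
  ((hasDerivAt_exp ρ).const_add 1).log (by positivity)

theorem deriv_logPotential_canonicalMetric :
    deriv (logPotential canonicalMetric) = fun ρ => exp ρ / (1 + exp ρ) := by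
  rw [logPotential_canonicalMetric]
  exact funext fun ρ => (hasDerivAt_log_one_add_exp ρ).deriv

theorem deriv2_logPotential_canonicalMetric :
    deriv (deriv (logPotential canonicalMetric)) = fun ρ => exp ρ / (1 + exp ρ) ^ 2 := by
  rw [deriv_logPotential_canonicalMetric]
  ext ρ
  have hne : 1 + exp ρ ≠ 0 := by positivity
  have := (hasDerivAt_exp ρ).div ((hasDerivAt_exp ρ).const_add 1) hne
  refine (this.congr_deriv ?_).deriv
  congr 1
  ring

theorem evenFamily_canonical : EvenFamily (fun _ r => log (1 + r ^ 2)) := by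
  refine ⟨?_, fun t _ => deriv_zero_of_even fun r => by rw [neg_sq]⟩
  refine ContDiff.contDiffOn ?_
  refine ContDiff.log (by fun_prop) fun p => by positivity

/-- The metric is symmetric under exchange of the poles, so one even family `log (1 + r ^ 2)` serves
both charts. -/
theorem uniformPotential_canonical :
    UniformPotential (fun _ : Unit => logPotential canonicalMetric) := by
  refine uniformPotential_of_evenFamily (s := fun _ => 0) (fun _ => by simp) evenFamily_canonical
    evenFamily_canonical (fun _ ρ => ?_) (fun _ ρ => ?_) (fun R => ?_)
  · rw [logPotential_canonicalMetric, ← exp_nat_mul]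
    congr 3
    push_cast
    ring
  · rw [logPotential_canonicalMetric, ← exp_nat_mul]
    nth_rewrite 3 [← log_exp ρ]
    have e : ((2 : ℕ) : ℝ) * (-ρ / 2) + ρ = 0 := by push_cast; ring
    rw [← log_mul (by positivity) (by positivity), add_mul, ← exp_add, one_mul, e, exp_zero,
      add_comm (exp ρ)]
  · refine ⟨1 / (1 + exp R) ^ 2, by positivity, fun _ ρ hρ => ?_⟩
    rw [deriv2_logPotential_canonicalMetric]
    simp only
    rw [one_div, mul_comm, ← div_eq_mul_inv]
    gcongr

theorem chart_canonicalMetric (z : ℂ) (hz : z ≠ 0) :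
    chart canonicalMetric z = logPotential canonicalMetric (log (‖z‖ ^ 2)) := by
  rw [logPotential_canonicalMetric]
  simp only
  rw [exp_log (by positivity)]
  simp [chart, canonicalMetric]

theorem legendre_canonical {x : ℝ} (hx : x ∈ Ioo (0 : ℝ) 1) :
    legendre (logPotential canonicalMetric) x = canonicalPotential x ∧
    iteratedDeriv 2 (legendre (logPotential canonicalMetric)) x = 1 / (x * (1 - x)) := by
  have h := uniformPotential_canonical.toric ()
  have hx1 : 0 < 1 - x := by linarith [hx.2]
  have hx0 := hx.1
  set ρ := log (x / (1 - x)) with hρ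
  have e1 : exp ρ = x / (1 - x) := exp_log (by positivity)
  have e2 : 1 + exp ρ = 1 / (1 - x) := by rw [e1]; field_simp; ring
  have e3 : deriv (logPotential canonicalMetric) ρ = x := by
    rw [deriv_logPotential_canonicalMetric]
    simp only
    rw [e2, e1]
    field_simp
  constructor
  · have := h.legendre_deriv ρ
    rw [e3] at this
    rw [this, logPotential_canonicalMetric]
    simp only
    rw [e2, hρ, log_div hx0.ne' hx1.ne', one_div, log_inv, canonicalPotential]
    ring
  · have := h.iteratedDeriv_two_legendre ρ
    rw [e3, deriv2_logPotential_canonicalMetric] at this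
    rw [this]
    simp only
    rw [e2, e1]
    field_simp

theorem canonicalPotential_eventuallyEq {x : ℝ} (hx : x ∈ Ioo (0 : ℝ) 1) :
    canonicalPotential =ᶠ[𝓝 x] legendre (logPotential canonicalMetric) := by
  filter_upwards [isOpen_Ioo.mem_nhds hx] with y hy
  exact (legendre_canonical hy).1.symm

theorem iteratedDeriv_two_canonicalPotential {x : ℝ} (hx : x ∈ Ioo (0 : ℝ) 1) :
    iteratedDeriv 2 canonicalPotential x = 1 / (x * (1 - x)) := by
  rw [(canonicalPotential_eventuallyEq hx).iteratedDeriv_eq, (legendre_canonical hx).2]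

theorem canonicalNormingConstant_eq {x : ℝ} (hx : x ∈ Ioo (0 : ℝ) 1) (N : ℕ) :
    canonicalNormingConstant N x = 2 * π * logNorming (logPotential canonicalMetric) N x := by
  rw [← normingConstant_eq (uniformPotential_canonical.toric ()).smooth chart_canonicalMetric,
    canonicalNormingConstant, normingConstant, ← (legendre_canonical hx).1]
  rfl

theorem ToricPotential.iteratedDeriv_two_sub {U V : ℝ → ℝ} (hU : ToricPotential U)
    (hV : ToricPotential V) {x : ℝ} (hx : x ∈ Ioo (0 : ℝ) 1) :
    iteratedDeriv 2 (fun y => legendre U y - legendre V y) x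
      = iteratedDeriv 2 (legendre U) x - iteratedDeriv 2 (legendre V) x := by
  have hd : ∀ {W : ℝ → ℝ}, ToricPotential W → ∀ y ∈ Ioo (0 : ℝ) 1,
      DifferentiableAt ℝ (legendre W) y ∧ DifferentiableAt ℝ (deriv (legendre W)) y := by
    intro W hW y hy
    obtain ⟨ρ, rfl⟩ := hW.exists_deriv_eq hy
    exact ⟨(hW.hasDerivAt_legendre ρ).differentiableAt,
      (hW.hasDerivAt_deriv_legendre ρ).differentiableAt⟩
  simp only [iteratedDeriv_succ, iteratedDeriv_zero]
  have h1 : deriv (fun y => legendre U y - legendre V y) =ᶠ[𝓝 x]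
      fun y => deriv (legendre U) y - deriv (legendre V) y := by
    filter_upwards [isOpen_Ioo.mem_nhds hx] with y hy
    exact deriv_fun_sub (hd hU y hy).1 (hd hV y hy).1
  rw [h1.deriv_eq]
  exact deriv_fun_sub (hd hU x hx).2 (hd hV x hx).2

end Canonical

/-! ### Quotients of asymptotic expansions -/

/-- The coefficients of the quotient of two formal power series. -/
noncomputable def quotientCoeff (a b : ℕ → ℝ) : ℕ → ℝ
  | k => (a k - ∑ j : Fin k, quotientCoeff a b j * b (k - j)) / b 0

theorem sum_quotientCoeff_mul (a b : ℕ → ℝ) (hb : b 0 ≠ 0) (k : ℕ) :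
    ∑ j ∈ Finset.range (k + 1), quotientCoeff a b j * b (k - j) = a k := by
  have e : quotientCoeff a b k
      = (a k - ∑ j : Fin k, quotientCoeff a b j * b (k - j)) / b 0 := by rw [quotientCoeff]
  rw [Finset.sum_range_succ, Nat.sub_self, e, div_mul_cancel₀ _ hb, Finset.sum_range (fun j => quotientCoeff a b j * b (k - j))]
  ring

theorem quotientCoeff_zero (a b : ℕ → ℝ) : quotientCoeff a b 0 = a 0 / b 0 := by
  rw [quotientCoeff]
  simp

theorem exists_bound_quotientCoeff {κ : Type*} {a b : ℕ → κ → ℝ} {β : ℝ} (hβ : 0 < β)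
    (hb0 : ∀ q, β ≤ b 0 q) (ha : ∀ k, ∃ D : ℝ, ∀ q, |a k q| ≤ D)
    (hb : ∀ k, ∃ D : ℝ, ∀ q, |b k q| ≤ D) (k : ℕ) :
    ∃ D : ℝ, ∀ q, |quotientCoeff (a · q) (b · q) k| ≤ D := by
  induction k using Nat.strong_induction_on with
  | _ k ih =>
    choose A hA using ha
    choose B hB using hb
    choose! C hC using ih
    refine ⟨(|A k| + ∑ j : Fin k, |C j| * |B (k - j)|) / β, fun q => ?_⟩
    rw [quotientCoeff, abs_div, abs_of_pos (hβ.trans_le (hb0 q))]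
    refine div_le_div₀ (by positivity) ?_ hβ (hb0 q)
    refine (abs_sub _ _).trans (add_le_add ((hA k q).trans (le_abs_self _)) ?_)
    refine (Finset.abs_sum_le_sum_abs _ _).trans (Finset.sum_le_sum fun j _ => ?_)
    rw [abs_mul]
    exact mul_le_mul ((hC j j.2 q).trans (le_abs_self _)) ((hB _ q).trans (le_abs_self _))
      (abs_nonneg _) (abs_nonneg _)

/-- The quotient of two uniform asymptotic expansions in powers of `1 / M`. -/
theorem exists_quotient_expansion {κ J : Type*} (p : J → κ) {M X Y : J → ℝ} {a b : ℕ → κ → ℝ}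
    {β ℓ : ℝ} (hM : ∀ j, 1 ≤ M j) (hβ : 0 < β) (hb0 : ∀ q, β ≤ b 0 q) (hℓ : 0 < ℓ)
    (hY0 : ∀ j, ℓ ≤ Y j) (ha : ∀ k, ∃ D : ℝ, ∀ q, |a k q| ≤ D)
    (hb : ∀ k, ∃ D : ℝ, ∀ q, |b k q| ≤ D)
    (hX : ∀ R : ℕ, ∃ C : ℝ, ∀ j,
      |X j - ∑ k ∈ Finset.range (R + 1), a k (p j) / M j ^ k| ≤ C / M j ^ (R + 1))
    (hY : ∀ R : ℕ, ∃ C : ℝ, ∀ j,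
      |Y j - ∑ k ∈ Finset.range (R + 1), b k (p j) / M j ^ k| ≤ C / M j ^ (R + 1)) (R : ℕ) :
    ∃ C : ℝ, ∀ j, |X j / Y j - ∑ k ∈ Finset.range (R + 1),
      quotientCoeff (a · (p j)) (b · (p j)) k / M j ^ k| ≤ C / M j ^ (R + 1) := by
  obtain ⟨A, hA⟩ := hX R
  choose B hB using hY
  choose D hD using exists_bound_quotientCoeff hβ hb0 ha hb
  refine ⟨(|A| + ∑ i ∈ Finset.range (R + 1), |D i| * |B (R - i)|) / ℓ, fun j => ?_⟩
  set c := quotientCoeff (a · (p j)) (b · (p j)) with hc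
  have hM0 : 0 < M j := by linarith [hM j]
  have hYj : 0 < Y j := hℓ.trans_le (hY0 j)
  have hbne : b 0 (p j) ≠ 0 := (hβ.trans_le (hb0 _)).ne'
  set P := M j ^ (R + 1) with hP
  have hP0 : 0 < P := by positivity
  have key : ∑ k ∈ Finset.range (R + 1), a k (p j) / M j ^ k
      = ∑ i ∈ Finset.range (R + 1), c i / M j ^ i *
        ∑ l ∈ Finset.range (R + 1 - i), b l (p j) / M j ^ l := by
    calc _ = ∑ k ∈ Finset.range (R + 1), ∑ i ∈ Finset.range (k + 1),
          (fun i l => c i / M j ^ i * (b l (p j) / M j ^ l)) i (k - i) := by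
          refine Finset.sum_congr rfl fun k _ => ?_
          rw [← sum_quotientCoeff_mul (a · (p j)) (b · (p j)) hbne k, Finset.sum_div]
          refine Finset.sum_congr rfl fun i hi => ?_
          have hik : i ≤ k := by simpa [Nat.lt_succ_iff] using hi
          simp only
          rw [div_mul_div_comm, ← pow_add, Nat.add_sub_cancel' hik]
      _ = _ := by
          rw [Finset.sum_range_diag_flip (R + 1)
            (fun i l => c i / M j ^ i * (b l (p j) / M j ^ l))]
          simp only [Finset.mul_sum]
  -- The Cauchy product pairs `c i / M ^ i` with the expansion of `Y` cut at order `R - i`, so each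
  -- product of a coefficient term with its error has order `R + 1`.
  have hdiff : X j - Y j * ∑ k ∈ Finset.range (R + 1), c k / M j ^ k
      = (X j - ∑ k ∈ Finset.range (R + 1), a k (p j) / M j ^ k)
        - ∑ i ∈ Finset.range (R + 1), c i / M j ^ i *
          (Y j - ∑ l ∈ Finset.range (R + 1 - i), b l (p j) / M j ^ l) := by
    simp only [mul_sub, Finset.sum_sub_distrib]
    rw [key, Finset.mul_sum]
    simp only [mul_comm (Y j)]
    ring
  have hle : |X j - Y j * ∑ k ∈ Finset.range (R + 1), c k / M j ^ k|
      ≤ (|A| + ∑ i ∈ Finset.range (R + 1), |D i| * |B (R - i)|) / P := by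
    rw [hdiff, add_div]
    refine (abs_sub _ _).trans (add_le_add ((hA j).trans (by gcongr; exact le_abs_self A)) ?_)
    rw [Finset.sum_div]
    refine (Finset.abs_sum_le_sum_abs _ _).trans (Finset.sum_le_sum fun i hi => ?_)
    have hiR : i ≤ R := by simpa [Nat.lt_succ_iff] using hi
    have h1 := hB (R - i) j
    rw [← Nat.sub_add_comm hiR] at h1
    have h2 : P = M j ^ i * M j ^ (R + 1 - i) := by
      rw [← pow_add, Nat.add_sub_cancel' (by omega)]
    rw [abs_mul, abs_div, abs_of_pos (by positivity : 0 < M j ^ i), h2, ← div_mul_div_comm]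
    refine mul_le_mul ?_ (h1.trans ?_) (abs_nonneg _) (by positivity)
    · exact div_le_div_of_nonneg_right ((hD i _).trans (le_abs_self _)) (by positivity)
    · exact div_le_div_of_nonneg_right (le_abs_self _) (by positivity)
  have hfin : X j / Y j - ∑ k ∈ Finset.range (R + 1), c k / M j ^ k
      = (X j - Y j * ∑ k ∈ Finset.range (R + 1), c k / M j ^ k) / Y j := by
    field_simp
  rw [hfin, abs_div, abs_of_pos hYj, div_right_comm]
  exact div_le_div₀ (by positivity) hle hℓ (hY0 j)

/-- Raising `x ≥ N ^ (-3/4)` to the fourth power gives `N³ x⁴ ≥ 1`, which is the cubic bound needed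
for the tail. -/
theorem le_mul_of_rpow_le {N : ℕ} (hN : 0 < N) {x : ℝ} (hx : (N : ℝ) ^ (-(3 / 4) : ℝ) ≤ x) :
    0 < x ∧ 1 ≤ N * x ∧ 1 / x ≤ (N * x) ^ 3 := by
  have hN1 : (1 : ℝ) ≤ N := by exact_mod_cast hN
  have hN0 : (0 : ℝ) < N := by linarith
  have h0 : 0 < (N : ℝ) ^ (-(3 / 4) : ℝ) := rpow_pos_of_pos hN0 _
  have hx0 : 0 < x := h0.trans_le hx
  refine ⟨hx0, ?_, ?_⟩
  · have h1 : (N : ℝ) ^ (-1 : ℝ) ≤ (N : ℝ) ^ (-(3 / 4) : ℝ) :=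
      rpow_le_rpow_of_exponent_le hN1 (by norm_num)
    rw [rpow_neg_one] at h1
    calc (1 : ℝ) = N * (N : ℝ)⁻¹ := by field_simp
      _ ≤ N * x := by gcongr; exact h1.trans hx
  · have h4 : ((N : ℝ) ^ (-(3 / 4) : ℝ)) ^ 4 = ((N : ℝ) ^ 3)⁻¹ := by
      rw [← rpow_natCast, ← rpow_mul hN0.le, ← rpow_natCast, ← rpow_neg hN0.le]
      norm_num
    have h5 : ((N : ℝ) ^ 3)⁻¹ ≤ x ^ 4 := by
      rw [← h4]; gcongr
    rw [div_le_iff₀ hx0]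
    calc (1 : ℝ) = (N : ℝ) ^ 3 * ((N : ℝ) ^ 3)⁻¹ := by field_simp
      _ ≤ (N : ℝ) ^ 3 * x ^ 4 := by gcongr
      _ = _ := by ring

/-! ### The ratio of norming constants -/

section Main

variable {φ : ℝ → ℂ × ℂ → ℝ}

theorem IsToricGeodesic.second_derivatives (hφ : IsToricGeodesic φ) {t : ℝ}
    (ht : t ∈ Icc (0 : ℝ) 1) {α : ℝ} (hα : α ∈ Ioo (0 : ℝ) 1) :
    0 < iteratedDeriv 2 (symplecticPotential (φ t)) α ∧
    1 + α * (1 - α) * iteratedDeriv 2 (potentialDifference (φ t)) α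
      = α * (1 - α) * iteratedDeriv 2 (symplecticPotential (φ t)) α := by
  have hU : ToricPotential (logPotential (φ t)) := hφ.uniformPotential.toric ⟨t, ht⟩
  have hP := uniformPotential_canonical.toric ()
  have hα0 := hα.1.ne'
  have hα1 : 1 - α ≠ 0 := by linarith [hα.2]
  constructor
  · obtain ⟨ρ, rfl⟩ := hU.exists_deriv_eq hα
    have := hU.iteratedDeriv_two_legendre ρ
    change 0 < iteratedDeriv 2 (legendre (logPotential (φ t))) _
    rw [this]
    exact inv_pos.2 (hU.pos ρ)
  · have h1 : potentialDifference (φ t) =ᶠ[𝓝 α] fun y =>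
        legendre (logPotential (φ t)) y - legendre (logPotential canonicalMetric) y := by
      filter_upwards [canonicalPotential_eventuallyEq hα] with y hy
      rw [potentialDifference, hy]
      rfl
    rw [h1.iteratedDeriv_eq, hU.iteratedDeriv_two_sub hP hα, (legendre_canonical hα).2]
    change _ = α * (1 - α) * iteratedDeriv 2 (legendre (logPotential (φ t))) α
    field_simp
    ring

theorem IsToricGeodesic.normingRatio_eq (hφ : IsToricGeodesic φ) {t : ℝ}
    (ht : t ∈ Icc (0 : ℝ) 1) {α : ℝ} (hα : α ∈ Ioo (0 : ℝ) 1) {N : ℕ} (hN : 0 < N) :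
    normingRatio (φ t) N α
      = (√(N * α) * (logNorming (logPotential (φ t)) N α / α))
        / (√(N * α) * (logNorming (logPotential canonicalMetric) N α / α)) := by
  have hs : √(N * α) ≠ 0 := (sqrt_pos.2 (mul_pos (by exact_mod_cast hN) hα.1)).ne'
  rw [normingRatio, canonicalNormingConstant_eq hα, normingConstant_eq
    (hφ.contDiff_logPotential ht) (fun z hz => chart_eq_logPotential (hφ.metric t ht).invariant hz),
    mul_div_mul_left _ _ (by positivity), mul_div_mul_left _ _ hs,
    div_div_div_cancel_right₀ hα.1.ne']

end Main

end ToricCP1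

open ToricCP1
theorem corollary3p3 (φ : ℝ → ℂ × ℂ → ℝ) (hφ : IsToricGeodesic φ) :
    -- positivity, and the two forms of the leading coefficient agree
    (∀ t ∈ Set.Icc (0 : ℝ) 1, ∀ α ∈ Set.Ioc (0 : ℝ) (2 / 3),
      0 < iteratedDeriv 2 (symplecticPotential (φ t)) α ∧
      0 < 1 + α * (1 - α) * iteratedDeriv 2 (potentialDifference (φ t)) α ∧
      iteratedDeriv 2 canonicalPotential α / iteratedDeriv 2 (symplecticPotential (φ t)) α
        = 1 / (1 + α * (1 - α) * iteratedDeriv 2 (potentialDifference (φ t)) α)) ∧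
    -- the complete asymptotic expansion
    (∃ B : ℕ → ℝ → ℝ → ℝ,
      (∀ t ∈ Set.Icc (0 : ℝ) 1, ∀ α ∈ Set.Ioc (0 : ℝ) (2 / 3), B 0 t α = 1) ∧
      (∀ k : ℕ, ∃ D : ℝ, ∀ t ∈ Set.Icc (0 : ℝ) 1, ∀ α ∈ Set.Ioc (0 : ℝ) (2 / 3),
        |B k t α| ≤ D) ∧
      (∀ R : ℕ, ∃ C : ℝ, 0 < C ∧ ∀ N : ℕ, 0 < N → ∀ t ∈ Set.Icc (0 : ℝ) 1,
        ∀ α ∈ Set.Icc ((N : ℝ) ^ (-(3 / 4) : ℝ)) (2 / 3),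
          |normingRatio (φ t) N α
            - √(iteratedDeriv 2 canonicalPotential α
                / iteratedDeriv 2 (symplecticPotential (φ t)) α)
              * ∑ k ∈ Finset.range (R + 1), B k t α / (N * α) ^ k|
          ≤ C / (N * α) ^ (R + 1))) ∧
    -- the uniform bounds
    (∃ C : ℝ, 0 < C ∧ ∀ N : ℕ, 0 < N → ∀ t ∈ Set.Icc (0 : ℝ) 1,
      ∀ α ∈ Set.Icc ((N : ℝ) ^ (-(3 / 4) : ℝ)) (2 / 3),
        1 / C ≤ normingRatio (φ t) N α ∧ normingRatio (φ t) N α ≤ C) := by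
  have hU := hφ.uniformPotential
  have hP := uniformPotential_canonical
  have hsub : ∀ α ∈ Set.Ioc (0 : ℝ) (2 / 3), α ∈ Set.Ioo (0 : ℝ) 1 := fun α h =>
    ⟨h.1, h.2.trans_lt (by norm_num)⟩
  -- the index sets of the coefficients and of the expansions
  let κ := Set.Icc (0 : ℝ) 1 × Set.Ioc (0 : ℝ) (2 / 3)
  let J := {j : ℕ × κ // 0 < j.1 ∧ (j.1 : ℝ) ^ (-(3 / 4) : ℝ) ≤ j.2.2}
  let p : J → κ := fun j => j.1.2
  let M : J → ℝ := fun j => j.1.1 * (j.1.2.2 : ℝ)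
  let X : J → ℝ := fun j =>
    √(M j) * (logNorming (logPotential (φ j.1.2.1)) j.1.1 j.1.2.2 / j.1.2.2)
  let Y : J → ℝ := fun j =>
    √(M j) * (logNorming (logPotential canonicalMetric) j.1.1 j.1.2.2 / j.1.2.2)
  let a : ℕ → κ → ℝ := fun k q => normingCoeff (logPotential (φ q.1)) k q.2
  let b : ℕ → κ → ℝ := fun k q => normingCoeff (logPotential canonicalMetric) k q.2
  have hM : ∀ j, 1 ≤ M j := fun j => (le_mul_of_rpow_le j.2.1 j.2.2).2.1
  have ha : ∀ k, ∃ D : ℝ, ∀ q, |a k q| ≤ D := fun k =>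
    (hU.exists_bound_normingCoeff k).imp fun D hD q => hD q.1 q.2 q.2.2
  have hb : ∀ k, ∃ D : ℝ, ∀ q, |b k q| ≤ D := fun k =>
    (hP.exists_bound_normingCoeff k).imp fun D hD q => hD () q.2 q.2.2
  obtain ⟨γ, hγ, ha0⟩ := hU.exists_lower_normingCoeff_zero
  obtain ⟨β, hβ, hb0⟩ := hP.exists_lower_normingCoeff_zero
  obtain ⟨ℓX, hℓX, hXl⟩ := hU.exists_lower_logNorming
  obtain ⟨ℓ, hℓ, hYl⟩ := hP.exists_lower_logNorming
  have hXlow : ∀ j, ℓX ≤ X j := fun j => hXl j.1.2.1 j.1.2.2 j.1.2.2.2 j.1.1 (hM j)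
  have hYlow : ∀ j, ℓ ≤ Y j := fun j => hYl () j.1.2.2 j.1.2.2.2 j.1.1 (hM j)
  have hX : ∀ R : ℕ, ∃ C : ℝ, ∀ j,
      |X j - ∑ k ∈ Finset.range (R + 1), a k (p j) / M j ^ k| ≤ C / M j ^ (R + 1) := fun R =>
    (hU.exists_expansion_logNorming R).imp fun C hC j =>
      hC j.1.2.1 j.1.2.2 j.1.2.2.2 j.1.1 (hM j) (le_mul_of_rpow_le j.2.1 j.2.2).2.2
  have hY : ∀ R : ℕ, ∃ C : ℝ, ∀ j,
      |Y j - ∑ k ∈ Finset.range (R + 1), b k (p j) / M j ^ k| ≤ C / M j ^ (R + 1) := fun R =>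
    (hP.exists_expansion_logNorming R).imp fun C hC j =>
      hC () j.1.2.2 j.1.2.2.2 j.1.1 (hM j) (le_mul_of_rpow_le j.2.1 j.2.2).2.2
  have hb0' : ∀ q, β ≤ b 0 q := fun q => hb0 () q.2 q.2.2
  have ha0' : ∀ q, γ ≤ a 0 q := fun q => ha0 q.1 q.2 q.2.2
  have hc := exists_bound_quotientCoeff hβ hb0' ha hb
  have hq := exists_quotient_expansion p hM hβ hb0' hℓ hYlow ha hb hX hY
  let c : ℕ → κ → ℝ := fun k q => quotientCoeff (a · q) (b · q) k
  have hratio : ∀ j : J, normingRatio (φ j.1.2.1) j.1.1 j.1.2.2 = X j / Y j := fun j =>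
    hφ.normingRatio_eq j.1.2.1.2 (hsub _ j.1.2.2.2) j.2.1
  have hfirst : ∀ t ∈ Set.Icc (0 : ℝ) 1, ∀ α ∈ Set.Ioc (0 : ℝ) (2 / 3),
      0 < iteratedDeriv 2 (symplecticPotential (φ t)) α ∧
      0 < 1 + α * (1 - α) * iteratedDeriv 2 (potentialDifference (φ t)) α ∧
      iteratedDeriv 2 canonicalPotential α / iteratedDeriv 2 (symplecticPotential (φ t)) α
        = 1 / (1 + α * (1 - α) * iteratedDeriv 2 (potentialDifference (φ t)) α) := by
    intro t ht α hα
    obtain ⟨h1, h2⟩ := hφ.second_derivatives ht (hsub α hα)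
    have hα0 := hα.1
    have hα1 : 0 < 1 - α := by linarith [(hsub α hα).2]
    refine ⟨h1, by rw [h2]; positivity, ?_⟩
    rw [h2, iteratedDeriv_two_canonicalPotential (hsub α hα), div_div]
  -- In the quotient of leading coefficients `√(2π)` and the factors `x` under the roots cancel.
  have hc0 : ∀ q : κ, c 0 q = √(iteratedDeriv 2 canonicalPotential (q.2 : ℝ)
      / iteratedDeriv 2 (symplecticPotential (φ q.1)) q.2) := by
    intro q
    have hq2 := hsub _ q.2.2
    have h1 := (hfirst q.1 q.1.2 q.2 q.2.2).1
    have hα0 := hq2.1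
    have hα1 : 0 < 1 - (q.2 : ℝ) := by linarith [hq2.2]
    have e1 : a 0 q = _ := hU.normingCoeff_zero q.1 q.2.2
    have e2 : b 0 q = _ := hP.normingCoeff_zero () q.2.2
    have e3 : c 0 q = a 0 q / b 0 q := quotientCoeff_zero _ _
    rw [e3, e1, e2, mul_div_mul_left _ _ (by positivity), ← Real.sqrt_div (by
      change 0 < iteratedDeriv 2 (legendre (logPotential (φ q.1))) (q.2 : ℝ) at h1
      positivity), (legendre_canonical hq2).2, iteratedDeriv_two_canonicalPotential hq2]
    congr 1
    change _ = 1 / ((q.2 : ℝ) * (1 - q.2)) / iteratedDeriv 2 (legendre (logPotential (φ q.1))) q.2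
    change 0 < iteratedDeriv 2 (legendre (logPotential (φ q.1))) (q.2 : ℝ) at h1
    field_simp
  obtain ⟨D0, hD0⟩ := hb 0
  have hc0low : ∀ q, γ / |D0| ≤ c 0 q := fun q => by
    have e3 : c 0 q = a 0 q / b 0 q := quotientCoeff_zero _ _
    rw [e3]
    have := hβ.trans_le (hb0' q)
    exact div_le_div₀ (hγ.le.trans (ha0' q)) (ha0' q) this
      ((le_abs_self _).trans ((hD0 q).trans (le_abs_self _)))
  have hc0pos : ∀ q, 0 < c 0 q := fun q => by
    have e3 : c 0 q = a 0 q / b 0 q := quotientCoeff_zero _ _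
    rw [e3]
    exact div_pos (hγ.trans_le (ha0' q)) (hβ.trans_le (hb0' q))
  have hD0pos : 0 < |D0| := by
    -- Any point of `κ` will do: `b 0` is positive there and at most `|D0|`.
    have q : κ := (⟨0, by simp⟩, ⟨1 / 2, by norm_num⟩)
    have := (hβ.trans_le (hb0' q)).trans_le ((le_abs_self _).trans ((hD0 q).trans (le_abs_self _)))
    exact this
  classical
  -- Dividing by `c 0` moves the square root in front of the sum and makes the zeroth coefficient 1;
  -- boundedness survives since `c 0` is bounded below. The value 0 off the domain is arbitrary.
  refine ⟨hfirst, ⟨fun k t α => if h : t ∈ Set.Icc (0 : ℝ) 1 ∧ α ∈ Set.Ioc (0 : ℝ) (2 / 3) then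
    c k (⟨t, h.1⟩, ⟨α, h.2⟩) / c 0 (⟨t, h.1⟩, ⟨α, h.2⟩) else 0, ?_, ?_, ?_⟩, ?_⟩
  · intro t ht α hα
    simp only [dif_pos (And.intro ht hα)]
    exact div_self (hc0pos _).ne'
  · intro k
    obtain ⟨D, hD⟩ := hc k
    refine ⟨D / (γ / |D0|), fun t ht α hα => ?_⟩
    simp only [dif_pos (And.intro ht hα)]
    rw [abs_div, abs_of_pos (hc0pos _)]
    have h1 := hD (⟨t, ht⟩, ⟨α, hα⟩)
    exact div_le_div₀ ((abs_nonneg _).trans h1) h1 (by positivity) (hc0low _)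
  · intro R
    obtain ⟨C, hC⟩ := hq R
    refine ⟨|C| + 1, by positivity, fun N hN t ht α hα => ?_⟩
    have hα0 := (le_mul_of_rpow_le hN hα.1).1
    have hα' : α ∈ Set.Ioc (0 : ℝ) (2 / 3) := ⟨hα0, hα.2⟩
    let j : J := ⟨(N, (⟨t, ht⟩, ⟨α, hα'⟩)), hN, hα.1⟩
    have h1 := hC j
    rw [← hratio j] at h1
    have h2 : ∑ k ∈ Finset.range (R + 1), c k (p j) / M j ^ k
        = √(iteratedDeriv 2 canonicalPotential α
          / iteratedDeriv 2 (symplecticPotential (φ t)) α)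
          * ∑ k ∈ Finset.range (R + 1), (c k (p j) / c 0 (p j)) / (N * α) ^ k := by
      rw [← hc0 (p j), Finset.mul_sum]
      refine Finset.sum_congr rfl fun k _ => ?_
      have := (hc0pos (p j)).ne'
      change c k (p j) / (N * α) ^ k = _
      field_simp
    simp only [dif_pos (And.intro ht hα')]
    have h3 : |normingRatio (φ t) N α - ∑ k ∈ Finset.range (R + 1), c k (p j) / M j ^ k|
        ≤ C / (N * α) ^ (R + 1) := h1
    rw [h2] at h3
    refine h3.trans ?_
    have hN0 : (0 : ℝ) < N := by exact_mod_cast hN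
    gcongr
    linarith [le_abs_self C]
  · obtain ⟨AX, hAX⟩ := ha 0
    obtain ⟨CX, hCX⟩ := hX 0
    obtain ⟨CY, hCY⟩ := hY 0
    -- Since `M ≥ 1`, the expansion with `R = 0` already bounds `X` and `Y` above.
    have hup : ∀ {Z : J → ℝ} {d : ℕ → κ → ℝ} {A C : ℝ}, (∀ q, |d 0 q| ≤ A) →
        (∀ j, |Z j - ∑ k ∈ Finset.range (0 + 1), d k (p j) / M j ^ k| ≤ C / M j ^ (0 + 1)) →
        ∀ j, Z j ≤ A + |C| := by
      intro Z d A C hd hZ j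
      have h1 := hZ j
      simp only [zero_add, Finset.range_one, Finset.sum_singleton, pow_zero, div_one,
        pow_one] at h1
      have h2 : C / M j ≤ |C| :=
        (div_le_div_of_nonneg_right (le_abs_self C) (by linarith [hM j])).trans
          (div_le_self (abs_nonneg C) (hM j))
      linarith [(abs_le.1 h1).2, le_abs_self (d 0 (p j)), hd (p j)]
    obtain ⟨DX, hXup⟩ : ∃ D, ∀ j, X j ≤ D := ⟨_, hup hAX hCX⟩
    obtain ⟨DY, hYup⟩ : ∃ D, ∀ j, Y j ≤ D := ⟨_, hup hD0 hCY⟩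
    have hq0 : ∀ j, ℓX / |DY| ≤ X j / Y j := fun j =>
      div_le_div₀ (hℓX.le.trans (hXlow j)) (hXlow j) (hℓ.trans_le (hYlow j))
        ((hYup j).trans (le_abs_self _))
    have hq1 : ∀ j, X j / Y j ≤ |DX| / ℓ := fun j =>
      div_le_div₀ (abs_nonneg _) ((hXup j).trans (le_abs_self _)) hℓ (hYlow j)
    have hC0 : 0 < |DY| / ℓX + |DX| / ℓ + 1 := by positivity
    refine ⟨|DY| / ℓX + |DX| / ℓ + 1, hC0, fun N hN t ht α hα => ?_⟩
    have hα0 := (le_mul_of_rpow_le hN hα.1).1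
    let j : J := ⟨(N, (⟨t, ht⟩, ⟨α, ⟨hα0, hα.2⟩⟩)), hN, hα.1⟩
    have hr : normingRatio (φ t) N α = X j / Y j := hratio j
    rw [hr]
    have hYpos : 0 < |DY| :=
      (hℓ.trans_le (hYlow j)).trans_le ((hYup j).trans (le_abs_self _))
    constructor
    · refine le_trans ?_ (hq0 j)
      rw [← one_div_div |DY| ℓX]
      refine one_div_le_one_div_of_le (by positivity) ?_
      have : 0 ≤ |DX| / ℓ := by positivity
      linarith
    · refine (hq1 j).trans ?_
      have : 0 ≤ |DY| / ℓX := by positivity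
      linarith
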